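/- Let $\rho$ be a plural similarity type of algebras, that is, a type with no nullary operation symbols and at least one non-unary operation symbol. Let $\mathcal V$ be a variety of algebras of type $\rho$ (the class of all algebras with non-empty universe that satisfy some fixed set of identities). Suppose that $\mathcal V$ is idempotent ($f(x,\dots,x)\approx x$ holds in $\mathcal V$ for every basic operation $f$) and tractable. Then its regularization $\widetilde{\mathcal V}$, the variety defined by all regular identities that hold in $\mathcal V$, is a tractable variety. Here an identity is regular if the same variables appear on both of its sides. For a finite list $\Delta$ of finitary relations on a non-empty finite set $A$, an instance of $\mathrm{CSP}(\Delta)$ consists of a finite set $X$ of variables and a finite list of constraints $(S,R)$, where $R\in\Delta$ is $m$-ary and $S\in X^m$; the instance is encoded as a finite binary string, and the question is whether there is a map $h\colon X\to A$ with $h(S)\in R$ for every constraint $(S,R)$. A finite algebra $\mathbf A$ is tractable if $\mathrm{CSP}(\Delta)$ lies in $\mathbf P$ for every finite set $\Delta$ of finitary relations on $A$ that are invariant under all basic operations of $\mathbf A$. A variety is tractable if all its finite members are tractable. -/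

import Mathlib

universe u v

/-! ### The constraint satisfaction problem and its complexity -/

namespace CSP

/-- A finitary relation on `A`: an arity `m` together with a set of `m`-tuples. -/
abbrev FinRel (A : Type u) : Type u := Σ m : ℕ, Set (Fin m → A)

/-- A constraint over a list of `k` relation symbols with arities `ar`: a relation symbol `i` and a
scope, that is, an `ar i`-tuple of variables taken from `{0, …, n - 1}`. -/
abbrev Constraint {k : ℕ} (ar : Fin k → ℕ) (n : ℕ) : Type := Σ i : Fin k, (Fin (ar i) → Fin n)

/-- An instance of the constraint satisfaction problem over a fixed finite list of relations with
arities `ar`. The variables are `0, …, numVars - 1`; the constraint relations are named by their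
position in the fixed list. -/
structure Instance {k : ℕ} (ar : Fin k → ℕ) : Type where
  numVars : ℕ
  constraints : List (Constraint ar numVars)

/-- The instance has a solution when its relation symbols denote the relations `Δ i` on `A`:
some assignment of values to the variables satisfies all the constraints. -/
def HasSolution {A : Type u} {k : ℕ} (Δ : Fin k → FinRel A)
    (I : Instance (fun i => (Δ i).1)) : Prop :=
  ∃ f : Fin I.numVars → A, ∀ c ∈ I.constraints, (fun j => f (c.2 j)) ∈ (Δ c.1).2

/-- The self-delimiting binary string `1 … 1 0` with `n` ones. -/
def encodeNat (n : ℕ) : List Bool := List.replicate n true ++ [false]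

/-- The string of a constraint: its relation symbol followed by the variables of its scope. -/
def encodeConstraint {k : ℕ} {ar : Fin k → ℕ} {n : ℕ} (c : Constraint ar n) : List Bool :=
  encodeNat c.1 ++ (List.ofFn fun j => encodeNat (c.2 j)).flatten

/-- The binary string of an instance: the number of variables followed by the constraints.
Since the finite set of variables is itself a part of an instance, the size of an instance is at
least its number of variables, so that writing the variables in unary changes sizes only
polynomially. -/
def encodeInstance {k : ℕ} {ar : Fin k → ℕ} (I : Instance ar) : List Bool :=
  encodeNat I.numVars ++ (I.constraints.map encodeConstraint).flatten

theorem encodeNat_append_inj {m n : ℕ} {s t : List Bool}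
    (h : encodeNat m ++ s = encodeNat n ++ t) : m = n ∧ s = t := by
  induction m generalizing n with
  | zero =>
    cases n with
    | zero => simpa [encodeNat] using h
    | succ n => simp [encodeNat, List.replicate_succ] at h
  | succ m ih =>
    cases n with
    | zero => simp [encodeNat, List.replicate_succ] at h
    | succ n =>
      have h' : encodeNat m ++ s = encodeNat n ++ t := by
        simpa [encodeNat, List.replicate_succ] using h
      obtain ⟨h1, h2⟩ := ih h'
      exact ⟨by rw [h1], h2⟩

theorem encodeTuple_append_inj {n m : ℕ} {a b : Fin m → Fin n} {s t : List Bool}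
    (h : (List.ofFn fun j => encodeNat (a j)).flatten ++ s =
      (List.ofFn fun j => encodeNat (b j)).flatten ++ t) : a = b ∧ s = t := by
  induction m with
  | zero => exact ⟨Subsingleton.elim _ _, by simpa using h⟩
  | succ m ih =>
    simp only [List.ofFn_succ, List.flatten_cons, List.append_assoc] at h
    obtain ⟨h0, h1⟩ := encodeNat_append_inj h
    obtain ⟨h2, h3⟩ := ih h1
    refine ⟨funext fun j => ?_, h3⟩
    refine Fin.cases (Fin.ext h0) (fun j => ?_) j
    exact congrFun h2 j

/-- Different instances have different strings. -/
theorem encodeInstance_injective {k : ℕ} (ar : Fin k → ℕ) :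
    Function.Injective (encodeInstance (ar := ar)) := by
  rintro ⟨n, C⟩ ⟨n', D⟩ h
  obtain ⟨h0, h1⟩ := encodeNat_append_inj h
  simp only at h0
  subst h0
  simp only at h1
  congr 1
  clear h
  have ne : ∀ c : Constraint ar n, ∀ s : List Bool, encodeConstraint c ++ s ≠ [] := by
    intro c s
    simp [encodeConstraint, encodeNat]
  induction C generalizing D with
  | nil =>
    cases D with
    | nil => rfl
    | cons d D => exact absurd h1.symm (ne d _)
  | cons c C ih =>
    cases D with
    | nil => exact absurd h1 (ne c _)
    | cons d D =>
      obtain ⟨i, a⟩ := c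
      obtain ⟨j, b⟩ := d
      simp only [List.map_cons, List.flatten_cons, encodeConstraint, List.append_assoc] at h1
      obtain ⟨h2, h3⟩ := encodeNat_append_inj h1
      obtain rfl : i = j := Fin.ext h2
      obtain ⟨rfl, h4⟩ := encodeTuple_append_inj h3
      rw [ih D h4]

/-- The decision problem `p`, whose instances `a : α` are presented as the binary strings `enc a`,
lies in P: a Turing machine answers it in a number of steps bounded by a polynomial in the length
of the string. -/
def InP {α : Type} (enc : α → List Bool) (p : α → Prop) : Prop :=
  ∃ f : α → Bool, (∀ a, f a = true ↔ p a) ∧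
    Nonempty (Turing.TM2ComputableInPolyTime enc Computability.encodeBool f)

/-- A set `Γ` of finitary relations on `A` is tractable if for every finite subset of `Γ`, here
given by a list `Δ 0, …, Δ (k - 1)` of its members, the constraint satisfaction problem over that
subset lies in P. -/
def IsTractable {A : Type u} (Γ : Set (FinRel A)) : Prop :=
  ∀ (k : ℕ) (Δ : Fin k → FinRel A), (∀ i, Δ i ∈ Γ) →
    InP (encodeInstance (ar := fun i => (Δ i).1)) (HasSolution Δ)

end CSP

/-! ### Algebras and varieties

A similarity type is a first-order language without relation symbols, and an algebra of that type
is a structure for the language. -/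

namespace UnivAlg

/-- A similarity type is plural if it has no nullary operation symbols and at least one non-unary
operation symbol. -/
def IsPlural (L : FirstOrder.Language.{u, v}) : Prop :=
  IsEmpty (L.Functions 0) ∧ ∃ n : ℕ, n ≠ 1 ∧ Nonempty (L.Functions n)

/-- The finitary relations on the algebra `A` that are invariant under all its basic operations. -/
def Inv (L : FirstOrder.Language.{u, v}) (A : Type u) [L.Structure A] : Set (CSP.FinRel A) :=
  {R | ∀ (n : ℕ) (f : L.Functions n) (a : Fin n → (Fin R.1 → A)), (∀ i, a i ∈ R.2) →
    (fun j => FirstOrder.Language.Structure.funMap f (fun i => a i j)) ∈ R.2}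

/-- An identity `s ≈ t` between terms in the variables `x₀, x₁, …`. -/
abbrev Identity (L : FirstOrder.Language.{u, v}) : Type u := L.Term ℕ × L.Term ℕ

/-- The algebra `A` satisfies the identity `e`. -/
def Satisfies {L : FirstOrder.Language.{u, v}} (A : Type u) [L.Structure A] (e : Identity L) : Prop :=
  ∀ x : ℕ → A, e.1.realize x = e.2.realize x

/-- An identity is regular if the same variables appear on both sides. -/
def IsRegular {L : FirstOrder.Language.{u, v}} (e : Identity L) : Prop :=
  e.1.varFinset = e.2.varFinset

/-- A class of algebras of type `L`. -/
abbrev AlgebraClass (L : FirstOrder.Language.{u, v}) : Type (max (u + 1) v) :=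
  (A : Type u) → L.Structure A → Prop

/-- The class of all algebras (with non-empty universe, as usual) that satisfy every identity
in `E`. -/
def models {L : FirstOrder.Language.{u, v}} (E : Set (Identity L)) : AlgebraClass L :=
  fun A _ => Nonempty A ∧ ∀ e ∈ E, Satisfies A e

/-- A variety is a class of algebras defined by a set of identities. -/
def IsVariety {L : FirstOrder.Language.{u, v}} (V : AlgebraClass L) : Prop :=
  ∃ E : Set (Identity L), V = models E

/-- The identity `e` holds in the class `V`, that is, in all of its members. -/
def HoldsIn {L : FirstOrder.Language.{u, v}} (V : AlgebraClass L) (e : Identity L) : Prop :=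
  ∀ (A : Type u) [S : L.Structure A], V A S → Satisfies A e

/-- The regularization of `V`: the variety defined by all regular identities that hold in `V`. -/
def regularization {L : FirstOrder.Language.{u, v}} (V : AlgebraClass L) : AlgebraClass L :=
  models {e | IsRegular e ∧ HoldsIn V e}

/-- `V` is idempotent: `f(x, …, x) ≈ x` holds in `V` for every basic operation `f`. -/
def IsIdempotent {L : FirstOrder.Language.{u, v}} (V : AlgebraClass L) : Prop :=
  ∀ (A : Type u) [S : L.Structure A], V A S →
    ∀ (n : ℕ) (f : L.Functions n) (a : A), FirstOrder.Language.Structure.funMap f (fun _ => a) = a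

/-- `V` is tractable: every finite algebra in `V` is tractable, that is, its invariant relations
form a tractable set of relations. -/
def IsTractable {L : FirstOrder.Language.{u, v}} (V : AlgebraClass L) : Prop :=
  ∀ (A : Type u) [S : L.Structure A] [Finite A], V A S → CSP.IsTractable (Inv L A)

end UnivAlg

/-! If every identity of `V` is regular, the regularization is contained in `V` and nothing is left
to prove. Otherwise an irregular identity, idempotence and a non-unary operation yield a binary term
`t(x, y)` in which both variables occur and which satisfies `t(x, y) ≈ x` in `V`
(`exists_projection_term`). On an algebra `A` of the regularization, `t` is no longer a projection,
but it obeys every regular law of a projection: it is a left normal band operation compatible with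
the basic operations (`exists_sumOperation`). This is Płonka's decomposition: `t` defines a
quasi-order on `A` whose classes are subalgebras belonging to `V`. For finite `A`, the product `P`
of these classes is a finite member of `V` (`product_mem_models`), hence tractable.

It remains to reduce a problem over `A` to one over `P` (`isTractable_inv`). Invariant relations are
closed under `t`, and `t(a, b)` lies above both `a` and `b`, so the tuples of a relation below a
given tuple of classes have a greatest one as soon as there are any. Start with the top class at
every variable, and replace the classes along a constraint by those of its greatest tuple until
nothing changes. Every solution stays below the resulting classes `s(x)`. At the fixed point each
constraint has a tuple lying exactly in those classes, and multiplying a solution by it pushes the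
solution into the classes `s(x)`. Thus an instance is solvable if and only if it is solvable with
every `x` confined to the class `s(x)`. That is an instance over finitely many invariant relations
of `P`, one for each relation of `A` and each tuple of classes.

Tractability refers to Turing machines, so the refinement has to be programmed and timed. Small
stack programs are composed with explicit time bounds. The sum of the ranks of the table entries
drops with every changing pass, which bounds the number of passes. The result is `inP_of_refine`,
transferred to constraint problems by `inP_hasSolution_of_refine`. -/

/-! ### Structured programs on stacks -/

namespace StackProgram

open Turing Function

variable {K : Type} {Γ : K → Type} {σ : Type}

/-- Replaces the labels of a statement along `f`, and `halt` by the statement `e`. -/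
def relabel {Λ Λ' : Type} (f : Λ → Λ') (e : TM2.Stmt Γ Λ' σ) : TM2.Stmt Γ Λ σ → TM2.Stmt Γ Λ' σ
  | .push k g q => .push k g (relabel f e q)
  | .peek k g q => .peek k g (relabel f e q)
  | .pop k g q => .pop k g (relabel f e q)
  | .load g q => .load g (relabel f e q)
  | .branch g q r => .branch g (relabel f e q) (relabel f e r)
  | .goto g => .goto fun v => f (g v)
  | .halt => e

/-- A stack machine with finitely many labels and a starting label; it exits by halting. -/
structure Prog {K : Type} (Γ : K → Type) (σ : Type) where
  Λ : Type
  [fin : Finite Λ]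
  main : Λ
  code : Λ → TM2.Stmt Γ Λ σ

attribute [instance] Prog.fin

namespace Prog

/-- A single statement. -/
def prim (q : TM2.Stmt Γ Unit σ) : Prog Γ σ where
  Λ := Unit
  main := ()
  code _ := q

/-- Run `P`, then `R`. -/
def seq (P R : Prog Γ σ) : Prog Γ σ where
  Λ := P.Λ ⊕ R.Λ
  main := .inl P.main
  code
    | .inl l => relabel .inl (.goto fun _ => .inr R.main) (P.code l)
    | .inr l => relabel .inr .halt (R.code l)

/-- Run `P` as long as the control state satisfies `p`. -/
def loop (p : σ → Bool) (P : Prog Γ σ) : Prog Γ σ where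
  Λ := Option P.Λ
  main := none
  code
    | none => .branch p (.goto fun _ => some P.main) .halt
    | some l => relabel some (.goto fun _ => none) (P.code l)

/-- Run the program `P i` whose index `i` is given by the control state. -/
def switch {ι : Type} [Finite ι] (sel : σ → ι) (P : ι → Prog Γ σ) : Prog Γ σ where
  Λ := Option (Σ i, (P i).Λ)
  main := none
  code
    | none => .goto fun v => some ⟨sel v, (P (sel v)).main⟩
    | some l => relabel (fun a => some ⟨l.1, a⟩) .halt ((P l.1).code l.2)

/-- Run `P` a fixed number of times. -/
def rep (P : Prog Γ σ) : ℕ → Prog Γ σ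
  | 0 => prim .halt
  | n + 1 => P.seq (P.rep n)

end Prog

variable [DecidableEq K]

/-- The configuration `c'` is reached from `c` in at most `n` steps. -/
inductive StepsTo {Λ : Type} (M : Λ → TM2.Stmt Γ Λ σ) : ℕ → TM2.Cfg Γ Λ σ → TM2.Cfg Γ Λ σ → Prop
  | refl (n : ℕ) (c : TM2.Cfg Γ Λ σ) : StepsTo M n c c
  | head {n : ℕ} {c c' c'' : TM2.Cfg Γ Λ σ} (h : TM2.step M c = some c')
      (h' : StepsTo M n c' c'') : StepsTo M (n + 1) c c''

namespace StepsTo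

variable {Λ : Type} {M : Λ → TM2.Stmt Γ Λ σ} {m n : ℕ} {a b c : TM2.Cfg Γ Λ σ}

theorem mono (h : StepsTo M m a b) (hmn : m ≤ n) : StepsTo M n a b := by
  induction h generalizing n with
  | refl => exact .refl _ _
  | head h _ ih =>
    obtain ⟨n, rfl⟩ : ∃ r, n = r + 1 := ⟨n - 1, by omega⟩
    exact .head h (ih (by omega))

theorem trans (h : StepsTo M m a b) (h' : StepsTo M n b c) : StepsTo M (m + n) a c := by
  induction h with
  | refl => exact h'.mono (by omega)
  | head h _ ih => exact (StepsTo.head h (ih h')).mono (by omega)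

theorem of_iterate (h : (flip bind (TM2.step M))^[n] (some a) = some b) : StepsTo M n a b := by
  induction n generalizing a with
  | zero =>
    obtain rfl : a = b := by simpa using h
    exact .refl _ _
  | succ n ih =>
    rw [Function.iterate_succ_apply] at h
    cases hs : TM2.step M a with
    | none =>
      -- A halted computation stays at `none`, so it cannot reach `some b` later.
      have h0 : ∀ r : ℕ, (flip bind (TM2.step M))^[r] none = none := fun r =>
        Function.iterate_fixed rfl r
      have h1 : flip bind (TM2.step M) (some a) = none := hs
      rw [h1, h0] at h
      cases h
    | some a' =>
      have h1 : flip bind (TM2.step M) (some a) = some a' := hs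
      rw [h1] at h
      exact .head hs (ih h)

theorem exists_iterate (h : StepsTo M n a b) :
    ∃ r ≤ n, (flip bind (TM2.step M))^[r] (some a) = some b := by
  induction h with
  | refl => exact ⟨0, Nat.zero_le _, rfl⟩
  | head h _ ih =>
    obtain ⟨r, hr, h'⟩ := ih
    refine ⟨r + 1, by omega, ?_⟩
    rw [Function.iterate_succ_apply, ← h']
    exact congrArg _ h

end StepsTo

/-- The two statements differ only at the leaves. Where the old one halts, the new one goes on with
`e` within the same machine step, so gluing programs together costs no time. -/
theorem stepAux_relabel {Λ Λ' : Type} (f : Λ → Λ') (e : TM2.Stmt Γ Λ' σ) (q : TM2.Stmt Γ Λ σ)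
    (v : σ) (S : ∀ k, List (Γ k)) :
    TM2.stepAux (relabel f e q) v S =
      match TM2.stepAux q v S with
      | ⟨some l, v', S'⟩ => ⟨some (f l), v', S'⟩
      | ⟨none, v', S'⟩ => TM2.stepAux e v' S' := by
  induction q generalizing v S with
  | branch g q r hq hr =>
    cases h : g v <;> simp [relabel, h, hq, hr]
  | goto g => simp [relabel]
  | halt => simp [relabel]
  | _ => simp_all [relabel]

theorem StepsTo.relabel {Λ Λ' : Type} {M : Λ → TM2.Stmt Γ Λ σ} {M' : Λ' → TM2.Stmt Γ Λ' σ}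
    {f : Λ → Λ'} {e : TM2.Stmt Γ Λ' σ} (hM : ∀ l, M' (f l) = StackProgram.relabel f e (M l))
    {n : ℕ} {l : Λ} {v v' : σ} {S S' : ∀ k, List (Γ k)}
    (h : StepsTo M n ⟨some l, v, S⟩ ⟨none, v', S'⟩) :
    StepsTo M' n ⟨some (f l), v, S⟩ (TM2.stepAux e v' S') := by
  generalize hc : (⟨some l, v, S⟩ : TM2.Cfg Γ Λ σ) = c at h
  generalize hd : (⟨none, v', S'⟩ : TM2.Cfg Γ Λ σ) = d at h
  induction h generalizing l v S with
  | refl => subst hc; cases hd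
  | @head n c c' c'' h h' ih =>
    subst hc hd
    simp only [TM2.step, Option.some.injEq] at h
    have key : TM2.step M' ⟨some (f l), v, S⟩ = some (TM2.stepAux (M' (f l)) v S) := rfl
    rw [hM, stepAux_relabel, h] at key
    -- A configuration without a label has no successor, so in the first case the rest of the run is
    -- empty.
    obtain ⟨_ | l', w, T⟩ := c'
    · have : (⟨none, w, T⟩ : TM2.Cfg Γ Λ σ) = ⟨none, v', S'⟩ := by
        cases h' with
        | refl => rfl
        | head h _ => cases h
      cases this
      exact .head key (.refl _ _)
    · exact .head key (ih rfl rfl)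

/-- Started with control state `v` and stacks `S`, the program `P` exits with control state `v'`
and stacks `S'` after at most `n` steps. -/
def Runs (P : Prog Γ σ) (v : σ) (S : ∀ k, List (Γ k)) (v' : σ) (S' : ∀ k, List (Γ k)) (n : ℕ) :
    Prop :=
  StepsTo P.code n ⟨some P.main, v, S⟩ ⟨none, v', S'⟩

namespace Runs

variable {P R : Prog Γ σ} {v v' v'' : σ} {S S' S'' : ∀ k, List (Γ k)} {m n : ℕ}

theorem mono (h : Runs P v S v' S' m) (hmn : m ≤ n) : Runs P v S v' S' n :=
  StepsTo.mono h hmn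

theorem prim {q : TM2.Stmt Γ Unit σ} (h : TM2.stepAux q v S = ⟨none, v', S'⟩) :
    Runs (.prim q) v S v' S' 1 :=
  .head (congrArg some h) (.refl _ _)

theorem seq (h : Runs P v S v' S' m) (h' : Runs R v' S' v'' S'' n) :
    Runs (P.seq R) v S v'' S'' (m + n) :=
  (StepsTo.relabel (M' := (P.seq R).code) (f := .inl) (e := .goto fun _ => .inr R.main)
    (fun _ => rfl) h).trans
    (StepsTo.relabel (M' := (P.seq R).code) (f := .inr) (e := .halt) (fun _ => rfl) h')

theorem loop_false {p : σ → Bool} (hp : p v = false) : Runs (P.loop p) v S v S 1 := by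
  refine .head (c' := ⟨none, v, S⟩) ?_ (.refl _ _)
  simp [Prog.loop, hp]

theorem loop_true {p : σ → Bool} (hp : p v = true) (h : Runs P v S v' S' m)
    (h' : Runs (P.loop p) v' S' v'' S'' n) : Runs (P.loop p) v S v'' S'' (m + n + 1) := by
  refine .head (c' := ⟨some (some P.main), v, S⟩) ?_
    ((StepsTo.relabel (M' := (P.loop p).code) (f := some) (e := .goto fun _ => none)
      (fun _ => rfl) h).trans h')
  simp [Prog.loop, hp]

theorem switch {ι : Type} [Finite ι] {sel : σ → ι} {P : ι → Prog Γ σ}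
    (h : Runs (P (sel v)) v S v' S' m) : Runs (.switch sel P) v S v' S' (m + 1) := by
  refine .head (c' := ⟨some (some ⟨sel v, (P (sel v)).main⟩), v, S⟩) ?_
    (StepsTo.relabel (M' := (Prog.switch sel P).code) (f := fun a => some ⟨sel v, a⟩) (e := .halt)
      (fun _ => rfl) h)
  simp [Prog.switch]

theorem rep_zero : Runs (P.rep 0) v S v S 1 := prim rfl

theorem rep_succ {r : ℕ} (h : Runs P v S v' S' m) (h' : Runs (P.rep r) v' S' v'' S'' n) :
    Runs (P.rep (r + 1)) v S v'' S'' (m + n) :=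
  h.seq h'

end Runs

/-! ### Embedding a machine into one with more stacks and more control states -/

section Embed

variable {K₁ : Type} [DecidableEq K₁] {e : K₁ → K} {τ : Type}

/-- The statement `q` on the stacks `e k` and on a component of the control state. -/
def embed {Λ : Type} (e : K₁ → K) (get : σ → τ) (set : σ → τ → σ) :
    TM2.Stmt (fun k => Γ (e k)) Λ τ → TM2.Stmt Γ Λ σ
  | .push k g q => .push (e k) (fun v => g (get v)) (embed e get set q)
  | .peek k g q => .peek (e k) (fun v x => set v (g (get v) x)) (embed e get set q)
  | .pop k g q => .pop (e k) (fun v x => set v (g (get v) x)) (embed e get set q)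
  | .load g q => .load (fun v => set v (g (get v))) (embed e get set q)
  | .branch g q r => .branch (fun v => g (get v)) (embed e get set q) (embed e get set r)
  | .goto g => .goto fun v => g (get v)
  | .halt => .halt

variable {get : σ → τ} {set : σ → τ → σ}

theorem update_comp_injective (he : Injective e) (S : ∀ k, List (Γ k)) (k : K₁)
    (l : List (Γ (e k))) :
    (fun k' => update S (e k) l (e k')) = update (fun k' => S (e k')) k l := by
  funext k'
  by_cases h : k' = k
  · subst h; simp
  · simp [update_of_ne h, update_of_ne (he.ne h)]

/-- The hypotheses on `get` and `set` say that the small control state is an independent component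
of the large one. With `e` injective, the embedded statement sees and changes only its own stacks
and component. -/
theorem stepAux_embed {Λ : Type} (he : Injective e) (get_set : ∀ v w, get (set v w) = w)
    (set_set : ∀ v w w', set (set v w) w' = set v w') (set_get : ∀ v, set v (get v) = v)
    (q : TM2.Stmt (fun k => Γ (e k)) Λ τ) (v : σ) (S : ∀ k, List (Γ k)) :
    ∃ S' : ∀ k, List (Γ k), (∀ k, k ∉ Set.range e → S' k = S k) ∧
      (fun k => S' (e k)) = (TM2.stepAux q (get v) fun k => S (e k)).stk ∧
      TM2.stepAux (embed e get set q) v S =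
        ⟨(TM2.stepAux q (get v) fun k => S (e k)).l,
          set v (TM2.stepAux q (get v) fun k => S (e k)).var, S'⟩ := by
  induction q generalizing v S with
  | push k g q ih =>
    obtain ⟨S', h1, h2, h3⟩ := ih v (update S (e k) (g (get v) :: S (e k)))
    rw [update_comp_injective he] at h2 h3
    refine ⟨S', fun k' hk' => ?_, h2, h3⟩
    rw [h1 k' hk', update_of_ne fun h => hk' ⟨k, h.symm⟩]
  | peek k g q ih =>
    obtain ⟨S', h1, h2, h3⟩ := ih (set v (g (get v) (S (e k)).head?)) S
    rw [get_set] at h2 h3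
    rw [set_set] at h3
    exact ⟨S', h1, h2, h3⟩
  | pop k g q ih =>
    obtain ⟨S', h1, h2, h3⟩ :=
      ih (set v (g (get v) (S (e k)).head?)) (update S (e k) (S (e k)).tail)
    rw [get_set, update_comp_injective he] at h2 h3
    rw [set_set] at h3
    refine ⟨S', fun k' hk' => ?_, h2, h3⟩
    rw [h1 k' hk', update_of_ne fun h => hk' ⟨k, h.symm⟩]
  | load g q ih =>
    obtain ⟨S', h1, h2, h3⟩ := ih (set v (g (get v))) S
    rw [get_set] at h2 h3
    rw [set_set] at h3
    exact ⟨S', h1, h2, h3⟩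
  | branch g q r hq hr =>
    cases h : g (get v)
    · simpa [embed, h] using hr v S
    · simpa [embed, h] using hq v S
  | goto g => exact ⟨S, fun _ _ => rfl, rfl, by simp [embed, set_get]⟩
  | halt => exact ⟨S, fun _ _ => rfl, rfl, by simp [embed, set_get]⟩

theorem StepsTo.embed {Λ : Type} {M : Λ → TM2.Stmt (fun k => Γ (e k)) Λ τ} (he : Injective e)
    (get_set : ∀ v w, get (set v w) = w) (set_set : ∀ v w w', set (set v w) w' = set v w')
    (set_get : ∀ v, set v (get v) = v) {n : ℕ} {c c' : TM2.Cfg (fun k => Γ (e k)) Λ τ}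
    (h : StepsTo M n c c') {v : σ} {S : ∀ k, List (Γ k)} (hv : get v = c.var)
    (hS : (fun k => S (e k)) = c.stk) :
    ∃ S' : ∀ k, List (Γ k), (∀ k, k ∉ Set.range e → S' k = S k) ∧ (fun k => S' (e k)) = c'.stk ∧
      StepsTo (fun l => StackProgram.embed e get set (M l)) n ⟨c.l, v, S⟩
        ⟨c'.l, set v c'.var, S'⟩ := by
  induction h generalizing v S with
  | refl =>
    refine ⟨S, fun _ _ => rfl, hS, ?_⟩
    rw [← hv, set_get]
    exact .refl _ _
  | @head n c c' c'' h h' ih =>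
    obtain ⟨_ | l, w, T⟩ := c
    · cases h
    · simp only at hv hS
      subst hv hS
      simp only [TM2.step, Option.some.injEq] at h
      subst h
      obtain ⟨S₁, h1, h2, h3⟩ := stepAux_embed he get_set set_set set_get (M l) v S
      obtain ⟨S₂, h4, h5, h6⟩ := ih (get_set v _) h2
      rw [set_set] at h6
      exact ⟨S₂, fun k hk => (h4 k hk).trans (h1 k hk), h5, .head (congrArg some h3) h6⟩

end Embed

end StackProgram

/-! ### Programs for table look-up -/

namespace StackProgram

open Turing Function

/-- The working stacks: unread input, input already read, the scope that is being read,
the table of values, a stack for walking down the table, and the output. -/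
inductive Tape
  | inp | done | scope | table | walk | out
  deriving DecidableEq

instance : Fintype Tape where
  elems := {.inp, .done, .scope, .table, .walk, .out}
  complete a := by cases a <;> decide

/-- The working stacks hold bits and values; the other stacks belong to an embedded machine. -/
abbrev Alphabet (Q : Type) {K : Type} (Γ : K → Type) : Tape ⊕ K → Type
  | .inl _ => Bool ⊕ Q
  | .inr k => Γ k

/-- The control states: a register, a relation symbol, a tuple of values, a flag that records
whether the table has changed, and a control state of an embedded machine. -/
@[ext]
structure Control (Q σ : Type) (k m : ℕ) where
  reg : Option (Bool ⊕ Q)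
  idx : Fin (k + 1)
  tup : {l : List Q // l.length ≤ m}
  changed : Bool
  emb : σ

instance Control.finite {Q σ : Type} [Finite Q] [Finite σ] {k m : ℕ} :
    Finite (Control Q σ k m) := by
  have : Finite {l : List Q // l.length ≤ m} := List.finite_length_le Q m
  refine Finite.of_injective (fun v => (v.reg, v.idx, v.tup, v.changed, v.emb)) fun v w h => ?_
  simp only [Prod.mk.injEq] at h
  exact Control.ext h.1 h.2.1 h.2.2.1 h.2.2.2.1 h.2.2.2.2

variable {Q K : Type} {Γ : K → Type} {σ : Type} {k m : ℕ}

namespace Control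

/-- The register holds the bit `1`. -/
def isOne (v : Control Q σ k m) : Bool :=
  match v.reg with
  | some (.inl b) => b
  | _ => false

def setReg (v : Control Q σ k m) (x : Option (Bool ⊕ Q)) : Control Q σ k m :=
  { v with reg := x }

def symbol (v : Control Q σ k m) : Bool ⊕ Q :=
  v.reg.getD (.inl false)

/-- Applies `u` to the value in the register. -/
def modify (u : Control Q σ k m → Q → Control Q σ k m × Q) (v : Control Q σ k m) :
    Control Q σ k m :=
  match v.reg with
  | some (.inr q) => (u (v.setReg none) q).1.setReg (some (.inr (u (v.setReg none) q).2))
  | _ => v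

@[simp] theorem setReg_setReg (v : Control Q σ k m) (x y : Option (Bool ⊕ Q)) :
    (v.setReg x).setReg y = v.setReg y := rfl

@[simp] theorem reg_setReg (v : Control Q σ k m) (x : Option (Bool ⊕ Q)) :
    (v.setReg x).reg = x := rfl

end Control

open Control

/-- The code of a number as a word on a working stack. -/
def num (n : ℕ) : List (Bool ⊕ Q) :=
  (CSP.encodeNat n).map .inl

theorem num_zero : (num 0 : List (Bool ⊕ Q)) = [.inl false] := rfl

theorem num_succ (n : ℕ) : (num (n + 1) : List (Bool ⊕ Q)) = .inl true :: num n := rfl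

theorem length_num (n : ℕ) : (num n : List (Bool ⊕ Q)).length = n + 1 := by
  simp [num, CSP.encodeNat]

variable (Γ σ k m) in
/-- Pops the working stack `a` into the register. -/
def popReg (a : Tape) : Prog (Alphabet Q Γ) (Control Q σ k m) :=
  .prim (.pop (.inl a) (fun v x => v.setReg x) .halt)

variable (σ k m) in
/-- Pops the whole stack `a` and pushes its symbols, translated by `φ` and `ψ`, onto `b`. -/
def moveAll (a b : Tape ⊕ K) (φ : Alphabet Q Γ a → Bool ⊕ Q) (ψ : Bool ⊕ Q → Alphabet Q Γ b) :
    Prog (Alphabet Q Γ) (Control Q σ k m) :=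
  (Prog.prim (.pop a (fun v x => v.setReg (x.map φ)) .halt)).seq <|
    .loop (fun v => v.reg.isSome) <|
      .prim (.push b (fun v => ψ v.symbol) (.pop a (fun v x => v.setReg (x.map φ)) .halt))

variable (Γ σ k m) in
/-- Moves the word on the working stack `a` to the working stack `b`. -/
def moveTape (a b : Tape) : Prog (Alphabet Q Γ) (Control Q σ k m) :=
  moveAll σ k m (.inl a) (.inl b) (fun x => x) (fun x => x)

variable (Γ σ k m) in
/-- Empties the working stack `a`. -/
def clear (a : Tape) : Prog (Alphabet Q Γ) (Control Q σ k m) :=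
  (popReg Γ σ k m a).seq <| .loop (fun v => v.reg.isSome) (popReg Γ σ k m a)

variable (Γ) in
/-- Reads the number of a variable on the input, moves it to `b` and applies `u` to the value of
that variable in the table. -/
def visit (b : Tape) (u : Control Q σ k m → Q → Control Q σ k m × Q) :
    Prog (Alphabet Q Γ) (Control Q σ k m) :=
  (popReg Γ σ k m .inp).seq <|
    (Prog.loop isOne <| .prim <|
      .push (.inl b) (fun _ => .inl true) <| .pop (.inl .table) (fun v x => v.setReg x) <|
        .push (.inl .walk) symbol <| .pop (.inl .inp) (fun v x => v.setReg x) .halt).seq <|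
    (Prog.prim <|
      .push (.inl b) (fun _ => .inl false) <|
        .pop (.inl .table) (fun v x => (v.setReg x).modify u) <|
          .push (.inl .table) symbol .halt).seq <|
    moveTape Γ σ k m .walk .table

variable [DecidableEq K]

theorem runs_popReg {a : Tape} {v : Control Q σ k m} {S : ∀ i, List (Alphabet Q Γ i)} :
    Runs (popReg Γ σ k m a) v S (v.setReg (S (.inl a)).head?)
      (update S (.inl a) (S (.inl a)).tail) 1 :=
  .prim rfl

theorem runs_moveAll {a b : Tape ⊕ K} (hab : a ≠ b) {φ : Alphabet Q Γ a → Bool ⊕ Q}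
    {ψ : Bool ⊕ Q → Alphabet Q Γ b} {v : Control Q σ k m} {S : ∀ i, List (Alphabet Q Γ i)} :
    Runs (moveAll σ k m a b φ ψ) v S (v.setReg none)
      (update (update S a []) b (((S a).map fun x => ψ (φ x)).reverse ++ S b))
      (2 * (S a).length + 2) := by
  -- Loop invariant: one symbol is always popped ahead, so the word `l` still to be moved is split
  -- into its head in the register and its tail on the stack.
  have key : ∀ (l : List (Alphabet Q Γ a)) (r : List (Alphabet Q Γ b)),
      Runs (.loop (fun v => v.reg.isSome) <|
          .prim (.push b (fun v => ψ v.symbol) (.pop a (fun v x => v.setReg (x.map φ)) .halt)))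
        (v.setReg (l.head?.map φ)) (update (update S a l.tail) b r) (v.setReg none)
        (update (update S a []) b ((l.map fun x => ψ (φ x)).reverse ++ r)) (2 * l.length + 1) := by
    intro l
    induction l with
    | nil => exact fun r => .loop_false rfl
    | cons x l ih =>
      intro r
      have := (Runs.loop_true rfl
        (.prim (S' := update (update S a l.tail) b (ψ (φ x) :: r)) (v' := v.setReg (l.head?.map φ))
          (v := v.setReg ((x :: l).head?.map φ)) (S := update (update S a l) b r) ?_)
        (ih (ψ (φ x) :: r)))
      · simp only [List.map_cons, List.reverse_cons, List.append_assoc, List.singleton_append,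
          List.length_cons, List.tail_cons]
        exact this.mono (by omega)
      · simp [symbol, update_comm hab, update_of_ne hab.symm]
  have h := key (S a) (S b)
  rw [← update_of_ne hab.symm (S a).tail S, update_eq_self, update_of_ne hab.symm] at h
  exact ((Runs.prim rfl).seq h).mono (by omega)

theorem runs_clear {a : Tape} {v : Control Q σ k m} {S : ∀ i, List (Alphabet Q Γ i)} :
    Runs (clear Γ σ k m a) v S (v.setReg none) (update S (.inl a) [])
      (2 * (S (.inl a)).length + 2) := by
  have key : ∀ l : List (Bool ⊕ Q),
      Runs (.loop (fun v => v.reg.isSome) (popReg Γ σ k m a)) (v.setReg l.head?)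
        (update S (.inl a) l.tail) (v.setReg none) (update S (.inl a) []) (2 * l.length + 1) := by
    intro l
    induction l with
    | nil => exact .loop_false rfl
    | cons x l ih =>
      have h := runs_popReg (a := a) (v := v.setReg (some x)) (S := update S (.inl a) l)
      simp only [update_self, update_idem, setReg_setReg] at h
      exact (Runs.loop_true rfl h ih).mono (by simp only [List.length_cons]; omega)
  exact (runs_popReg.seq (key (S (.inl a)))).mono (Nat.le_of_eq (by ring))

end StackProgram

/-! ### Stack layouts and access to the table of values. -/

namespace StackProgram

open Turing Function Control

section Frame

variable {Q K : Type} {Γ : K → Type} {σ : Type} {k m : ℕ}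

/-- The stacks `S` with new contents of the input, of the table, of the walking stack and of `b`. -/
def frame (S : ∀ i, List (Alphabet Q Γ i)) (b : Tape) (M D T X : List (Bool ⊕ Q)) :
    ∀ i, List (Alphabet Q Γ i)
  | .inl a => if a = .inp then M else if a = .table then T else if a = .walk then X else
      if a = b then D else S (.inl a)
  | .inr i => S (.inr i)

/-- All stacks. -/
def layout (M D N T X O : List (Bool ⊕ Q)) (S : ∀ i, List (Γ i)) : ∀ i, List (Alphabet Q Γ i)
  | .inl .inp => M
  | .inl .done => D
  | .inl .scope => N
  | .inl .table => T
  | .inl .walk => X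
  | .inl .out => O
  | .inr i => S i

/-- The codes of several numbers. -/
def nums (vs : List ℕ) : List (Bool ⊕ Q) :=
  vs.flatMap num

variable {S : ∀ i, List (Alphabet Q Γ i)} {SE : ∀ i, List (Γ i)} {b : Tape}
  {M D T X N O M' D' T' X' l : List (Bool ⊕ Q)}

theorem frame_scope : frame (layout M D N T X O SE) .scope M' D' T' X' =
    layout M' D D' T' X' O SE := by
  funext i; rcases i with a | i <;> [cases a; skip] <;> rfl

theorem frame_done : frame (layout M D N T X O SE) .done M' D' T' X' =
    layout M' D' N T' X' O SE := by
  funext i; rcases i with a | i <;> [cases a; skip] <;> rfl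

theorem frame_out : frame (layout M D N T X O SE) .out M' D' T' X' =
    layout M' D N T' X' D' SE := by
  funext i; rcases i with a | i <;> [cases a; skip] <;> rfl

theorem frame_inp : frame S b M D T X (.inl .inp) = M := rfl

theorem frame_table : frame S b M D T X (.inl .table) = T := rfl

theorem frame_walk : frame S b M D T X (.inl .walk) = X := rfl

/-- The stacks on which the input read so far can be kept. -/
def Tape.IsTarget (b : Tape) : Prop :=
  b ≠ .inp ∧ b ≠ .table ∧ b ≠ .walk

theorem frame_target (hb : b.IsTarget) : frame S b M D T X (.inl b) = D := by
  simp [frame, hb.1, hb.2.1, hb.2.2]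

variable [DecidableEq K]

theorem update_frame_inp : update (frame S b M D T X) (.inl .inp) M' = frame S b M' D T X := by
  funext i; rcases i with a | i <;> [cases a; skip] <;> rfl

theorem update_frame_table :
    update (frame S b M D T X) (.inl .table) T' = frame S b M D T' X := by
  funext i; rcases i with a | i <;> [cases a; skip] <;> rfl

theorem update_frame_walk :
    update (frame S b M D T X) (.inl .walk) X' = frame S b M D T X' := by
  funext i; rcases i with a | i <;> [cases a; skip] <;> rfl

theorem update_frame_target (hb : b.IsTarget) :
    update (frame S b M D T X) (.inl b) D' = frame S b M D' T X := by
  obtain ⟨h1, h2, h3⟩ := hb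
  funext i; rcases i with a | i <;> [(cases a <;> cases b <;> first | contradiction | rfl); rfl]

theorem update_layout_inp :
    update (layout M D N T X O SE) (.inl .inp) l = layout l D N T X O SE := by
  funext i; rcases i with a | i <;> [cases a; skip] <;> rfl

theorem update_layout_done :
    update (layout M D N T X O SE) (.inl .done) l = layout M l N T X O SE := by
  funext i; rcases i with a | i <;> [cases a; skip] <;> rfl

theorem update_layout_scope :
    update (layout M D N T X O SE) (.inl .scope) l = layout M D l T X O SE := by
  funext i; rcases i with a | i <;> [cases a; skip] <;> rfl

theorem update_layout_table :
    update (layout M D N T X O SE) (.inl .table) l = layout M D N l X O SE := by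
  funext i; rcases i with a | i <;> [cases a; skip] <;> rfl

theorem update_layout_out :
    update (layout M D N T X O SE) (.inl .out) l = layout M D N T X l SE := by
  funext i; rcases i with a | i <;> [cases a; skip] <;> rfl

theorem update_layout_inr (i : K) (l : List (Γ i)) :
    update (layout M D N T X O SE) (.inr i) l = layout M D N T X O (update SE i l) := by
  funext j
  rcases j with a | j
  · cases a <;> rfl
  · by_cases h : j = i
    · subst h; simp [layout]
    · simp [layout, h]

/-- The unary number drives the walk: each `1` moves one table entry to the walking stack, so at the
closing `0` the entry with that number is on top. It is treated there and the walked entries are put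
back. The time is `1 + (2 * A.length + 1) + 1 + (2 * A.length + 2)`. -/
theorem runs_visit (hb : b.IsTarget) {v : Control Q σ k m} (hv : v.reg = none)
    {u : Control Q σ k m → Q → Control Q σ k m × Q} {A : List (Bool ⊕ Q)} {q : Q} :
    Runs (visit Γ b u) v (frame S b (num A.length ++ M) D (A ++ .inr q :: T) [])
      ((u v q).1.setReg none)
      (frame S b M ((num A.length).reverse ++ D) (A ++ .inr (u v q).2 :: T) [])
      (4 * A.length + 5) := by
  have walk : ∀ (A D X : List (Bool ⊕ Q)),
      Runs (.loop isOne <| .prim <|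
        .push (.inl b) (fun _ => .inl true) <| .pop (.inl .table) (fun v x => v.setReg x) <|
        .push (.inl .walk) symbol <| .pop (.inl .inp) (fun v x => v.setReg x) .halt)
        (v.setReg (num A.length ++ M).head?)
        (frame S b (num A.length ++ M).tail D (A ++ .inr q :: T) X)
        (v.setReg (some (.inl false)))
        (frame S b M (List.replicate A.length (.inl true) ++ D) (.inr q :: T) (A.reverse ++ X))
        (2 * A.length + 1) := by
    intro A
    induction A with
    | nil => exact fun D X => .loop_false rfl
    | cons a A ih =>
      intro D X
      have h := ih (.inl true :: D) (a :: X)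
      rw [List.append_cons _ (.inl true) D, List.append_cons A.reverse a X, ← List.replicate_succ', ← List.reverse_cons,
        ← List.length_cons] at h
      refine (Runs.loop_true rfl (.prim ?_) h).mono (by simp only [List.length_cons]; omega)
      simp [frame_target hb, update_frame_target hb, frame_table, update_frame_table, frame_walk,
        update_frame_walk, frame_inp, update_frame_inp, num_succ, symbol]
  have h1 : Runs (popReg Γ σ k m .inp) v
      (frame S b (num A.length ++ M) D (A ++ .inr q :: T) [])
      (v.setReg (num A.length ++ M).head?)
      (frame S b (num A.length ++ M).tail D (A ++ .inr q :: T) []) 1 :=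
    .prim (by simp [frame_inp, update_frame_inp])
  have h3 : Runs (.prim (.push (.inl b) (fun _ => .inl false) <|
        .pop (.inl .table) (fun v x => (v.setReg x).modify u) <|
          .push (.inl .table) symbol .halt)) (v.setReg (some (.inl false)))
      (frame S b M (List.replicate A.length (.inl true) ++ D) (.inr q :: T) (A.reverse ++ []))
      ((u v q).1.setReg (some (.inr (u v q).2)))
      (frame S b M ((num A.length).reverse ++ D) (.inr (u v q).2 :: T) A.reverse) 1 := by
    -- `Control.modify` passes `u` a control state with an empty register; as `v` has one, this is
    -- `v` itself.
    have hv' : v.setReg none = v := by rw [← hv]; rfl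
    refine .prim ?_
    simp [frame_target hb, update_frame_target hb, frame_table, update_frame_table, symbol,
      Control.modify, hv', num, CSP.encodeNat]
  have h4 := runs_moveAll (a := .inl .walk) (b := .inl .table) (by simp)
    (φ := fun x => x) (ψ := fun x => x) (v := (u v q).1.setReg (some (.inr (u v q).2)))
    (S := frame S b M ((num A.length).reverse ++ D) (.inr (u v q).2 :: T) A.reverse)
  rw [frame_walk, frame_table, update_frame_walk, update_frame_table, List.map_id',
    List.reverse_reverse, List.length_reverse, setReg_setReg] at h4
  exact (h1.seq ((walk A D []).seq (h3.seq h4))).mono (by omega)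

/-- The effect of visiting several variables. -/
def visitAll (d : Q) (u : Control Q σ k m → Q → Control Q σ k m × Q) :
    List ℕ → Control Q σ k m → List Q → Control Q σ k m × List Q
  | [], v, s => (v, s)
  | x :: xs, v, s =>
    visitAll d u xs ((u v (s.getD x d)).1.setReg none) (s.set x (u v (s.getD x d)).2)

theorem runs_rep_visit (hb : b.IsTarget) (d : Q) {v : Control Q σ k m} (hv : v.reg = none)
    {u : Control Q σ k m → Q → Control Q σ k m × Q} {n : ℕ} {s : List Q} (hs : s.length = n)
    {xs : List ℕ} (hxs : ∀ x ∈ xs, x < n) {r : ℕ} (hr : xs.length = r) :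
    Runs ((visit Γ b u).rep r) v (frame S b (nums xs ++ M) D (s.map .inr) [])
      (visitAll d u xs v s).1
      (frame S b M ((nums xs).reverse ++ D) ((visitAll d u xs v s).2.map .inr) [])
      (r * (4 * n + 5) + 1) := by
  subst hr
  induction xs generalizing v D s with
  | nil => exact Runs.rep_zero.mono (by omega)
  | cons x xs ih =>
    have hx : x < s.length := hs ▸ hxs x (by simp)
    have hsplit := List.take_append_drop x s
    rw [List.drop_eq_getElem_cons hx] at hsplit
    have hlen : ((s.take x).map (Sum.inr : Q → Bool ⊕ Q)).length = x := by simp; omega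
    have h1 := runs_visit (S := S) (M := nums xs ++ M) (D := D) hb hv (u := u)
      (A := (s.take x).map .inr) (q := s[x]) (T := (s.drop (x + 1)).map .inr)
    have hset : s.take x ++ (u v s[x]).2 :: s.drop (x + 1) = s.set x (u v s[x]).2 := by
      rw [List.set_eq_take_append_cons_drop, if_pos hx]
    rw [hlen, ← List.map_cons, ← List.map_append, hsplit, ← List.map_cons, ← List.map_append,
      hset] at h1
    have hq : s.getD x d = s[x] := by simp [hx]
    have h2 := ih (D := (num x).reverse ++ D) (v := (u v s[x]).1.setReg none)
      (s := s.set x (u v s[x]).2) rfl (by simp [hs]) (fun y hy => hxs y (by simp [hy]))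
    rw [← hq] at h1 h2
    have := Runs.rep_succ h1 h2
    simp only [visitAll, nums, List.flatMap_cons, List.reverse_append, List.append_assoc,
      List.length_cons] at this ⊢
    refine this.mono ?_
    rw [Nat.add_mul]
    omega

end Frame

end StackProgram

/-! ### Refining a table of values along a list of constraints -/

namespace StackProgram

open Turing Function Control

/-- A rule for lowering the values of variables: a constraint with relation symbol `i` whose
variables have the values `l` proposes the values `update i l`, and a variable with value `q` that
is offered the value `r` gets the value `meet r q`. Initially all values are `top`. In the end,
a constraint with values `l` gets the relation symbol `code i l`. -/
structure Rule (Q : Type) (k m : ℕ) where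
  arity : Fin (k + 1) → ℕ
  arity_le : ∀ i, arity i ≤ m
  update : Fin (k + 1) → List Q → List Q
  length_update : ∀ i l, l.length = arity i → (update i l).length = arity i
  meet : Q → Q → Q
  top : Q
  code : Fin (k + 1) → List Q → ℕ

variable {Q : Type} {k m : ℕ}

namespace Rule

variable (R : Rule Q k m) [DecidableEq Q]

/-- Offers the values `rs` to the variables `xs`; the flag records a change. -/
def write : List Q → List ℕ → Bool × List Q → Bool × List Q
  | r :: rs, x :: xs, p =>
    write rs xs (p.1 || decide (R.meet r (p.2.getD x R.top) ≠ p.2.getD x R.top),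
      p.2.set x (R.meet r (p.2.getD x R.top)))
  | _, _, p => p

/-- The values of the variables `xs` in the table `s`. -/
def look (s : List Q) (xs : List ℕ) : List Q :=
  xs.map fun x => s.getD x R.top

/-- Treats one constraint. -/
def step (p : Bool × List Q) (c : Fin (k + 1) × List ℕ) : Bool × List Q :=
  R.write (R.update c.1 (R.look p.2 c.2)) c.2 p

/-- Treats all constraints once. -/
def pass (C : List (Fin (k + 1) × List ℕ)) (s : List Q) : Bool × List Q :=
  C.foldl R.step (false, s)

/-- The constraint has the right number of variables, and they are smaller than `n`. -/
def Valid (n : ℕ) (c : Fin (k + 1) × List ℕ) : Prop :=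
  c.2.length = R.arity c.1 ∧ ∀ x ∈ c.2, x < n

theorem length_write (rs : List Q) (xs : List ℕ) (p : Bool × List Q) :
    (R.write rs xs p).2.length = p.2.length := by
  induction rs generalizing xs p with
  | nil => rfl
  | cons r rs ih => cases xs with
    | nil => rfl
    | cons x xs => simp [write, ih]

theorem length_step (p : Bool × List Q) (c : Fin (k + 1) × List ℕ) :
    (R.step p c).2.length = p.2.length :=
  R.length_write _ _ _

theorem length_foldl_step (C : List (Fin (k + 1) × List ℕ)) (p : Bool × List Q) :
    (C.foldl R.step p).2.length = p.2.length := by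
  induction C generalizing p with
  | nil => rfl
  | cons c C ih => rw [List.foldl_cons, ih, length_step]

theorem length_pass (C : List (Fin (k + 1) × List ℕ)) (s : List Q) :
    (R.pass C s).2.length = s.length :=
  R.length_foldl_step C _

end Rule

/-- The word of a constraint. -/
def word (c : Fin (k + 1) × List ℕ) : List (Bool ⊕ Q) :=
  num c.1 ++ nums c.2

/-- The word of a list of constraints. -/
def words (C : List (Fin (k + 1) × List ℕ)) : List (Bool ⊕ Q) :=
  C.flatMap word

variable {K : Type} {Γ : K → Type} {σ : Type}

/-- Appends a value to the tuple. -/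
def addValue (v : Control Q σ k m) (q : Q) : Control Q σ k m × Q :=
  -- Truncation keeps the set of control states finite; it has no effect on scopes of length at most
  -- `m`.
  ({ v with tup := ⟨(v.tup.1 ++ [q]).take m, by simp⟩ }, q)

/-- Offers the first value of the tuple to a variable. -/
def writeValue [DecidableEq Q] (R : Rule Q k m) (v : Control Q σ k m) (q : Q) :
    Control Q σ k m × Q :=
  let q' := match v.tup.1.head? with
    | none => q
    | some r => R.meet r q
  ({ v with
      tup := ⟨v.tup.1.tail, by have := v.tup.2; simp only [List.length_tail]; omega⟩
      changed := v.changed || decide (q' ≠ q) }, q')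

variable (Γ σ k m) in
/-- Reads the relation symbol of a constraint; its first bit is already in the register. -/
def readIndex : Prog (Alphabet Q Γ) (Control Q σ k m) :=
  (Prog.prim (.load (fun v => { v with idx := 0, tup := ⟨[], by simp⟩ }) .halt)).seq <|
    (Prog.loop isOne <| .prim <| .push (.inl .done) (fun _ => .inl true) <|
      -- The count is modulo `k + 1`, which does not wrap for the symbols `0, …, k`.
      .load (fun v => { v with idx := Fin.ofNat (k + 1) (v.idx + 1) }) <|
        .pop (.inl .inp) (fun v x => v.setReg x) .halt).seq <|
    .prim <| .push (.inl .done) (fun _ => .inl false) <| .load (fun v => v.setReg none) .halt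

/-- Treats one constraint. -/
def stepProg [DecidableEq Q] (Γ : K → Type) (σ : Type) (R : Rule Q k m) :
    Prog (Alphabet Q Γ) (Control Q σ k m) :=
  (readIndex k m Γ σ).seq <|
    (Prog.switch Control.idx fun i =>
      ((visit Γ .scope addValue).rep (R.arity i)).seq <|
        (Prog.prim (.load (fun v => { v with
          tup := ⟨(R.update v.idx v.tup.1).take m, by simp⟩ }) .halt)).seq <|
        (moveTape Γ σ k m .scope .inp).seq <|
          (visit Γ .done (writeValue R)).rep (R.arity i)).seq <|
    popReg Γ σ k m .inp

/-- Treats all constraints once. -/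
def passProg [DecidableEq Q] (Γ : K → Type) (σ : Type) (R : Rule Q k m) :
    Prog (Alphabet Q Γ) (Control Q σ k m) :=
  (Prog.prim (.load (fun v => { v with changed := false }) .halt)).seq <|
    (popReg Γ σ k m .inp).seq <|
    (Prog.loop (fun v => v.reg.isSome) (stepProg Γ σ R)).seq <|
    moveTape Γ σ k m .done .inp

/-- Treats all constraints until the table does not change. -/
def fixProg [DecidableEq Q] (Γ : K → Type) (σ : Type) (R : Rule Q k m) :
    Prog (Alphabet Q Γ) (Control Q σ k m) :=
  (Prog.prim (.load (fun v => { v with changed := true }) .halt)).seq <|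
    .loop Control.changed (passProg Γ σ R)

/-- Puts out one constraint with its new relation symbol. -/
def outStepProg [Finite Q] [Finite σ] (Γ : K → Type) (R : Rule Q k m) :
    Prog (Alphabet Q Γ) (Control Q σ k m) :=
  (readIndex k m Γ σ).seq <|
    (Prog.switch Control.idx fun i =>
      ((visit Γ .scope addValue).rep (R.arity i)).seq <|
        (moveTape Γ σ k m .scope .inp).seq <|
        -- The number of ones to be written depends on the symbol and on the tuple read; since there
        -- are finitely many control states, each gets its own fixed loop-free program.
        (Prog.switch (fun v => v) fun v =>
          ((Prog.prim (.push (.inl .out) (fun _ => .inl true) .halt)).rep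
            (R.code v.idx v.tup.1)).seq <|
            .prim (.push (.inl .out) (fun _ => .inl false) .halt)).seq <|
          (visit Γ .out fun v q => (v, q)).rep (R.arity i)).seq <|
    popReg Γ σ k m .inp

/-- Puts out all constraints. -/
def outProg [Finite Q] [Finite σ] (Γ : K → Type) (R : Rule Q k m) :
    Prog (Alphabet Q Γ) (Control Q σ k m) :=
  (popReg Γ σ k m .inp).seq <| .loop (fun v => v.reg.isSome) (outStepProg Γ R)

/-- Reads the number of variables, puts it out, and initializes the table. -/
def headerProg (Γ : K → Type) (σ : Type) (R : Rule Q k m) :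
    Prog (Alphabet Q Γ) (Control Q σ k m) :=
  (popReg Γ σ k m .inp).seq <|
    (Prog.loop isOne <| .prim <| .push (.inl .out) (fun _ => .inl true) <|
      .push (.inl .table) (fun _ => .inr R.top) <|
        .pop (.inl .inp) (fun v x => v.setReg x) .halt).seq <|
    .prim (.push (.inl .out) (fun _ => .inl false) .halt)

/-- Replaces an instance, up to the order of symbols, by the refined one. -/
def refineProg [DecidableEq Q] [Finite Q] [Finite σ] (Γ : K → Type) (R : Rule Q k m) :
    Prog (Alphabet Q Γ) (Control Q σ k m) :=
  (headerProg Γ σ R).seq <| (fixProg Γ σ R).seq <| (outProg Γ R).seq <|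
    (clear Γ σ k m .done).seq (clear Γ σ k m .table)

theorem set_getD_self (s : List Q) (x : ℕ) (d : Q) : s.set x (s.getD x d) = s := by
  apply List.ext_getElem (by simp)
  intro j h1 h2
  rw [List.getElem_set]
  split
  · subst x
    rw [List.getD_eq_getElem]
  · rfl

theorem visitAll_addValue (d : Q) (xs : List ℕ) (i : Fin (k + 1))
    (t : List Q) (c : Bool) (e : σ) (s : List Q) (h : t.length + xs.length ≤ m) :
    visitAll d addValue xs (⟨none, i, ⟨t, by omega⟩, c, e⟩ : Control Q σ k m) s =
      (⟨none, i, ⟨t ++ xs.map fun x => s.getD x d, by simpa using h⟩, c, e⟩, s) := by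
  induction xs generalizing t with
  | nil => simp [visitAll]
  | cons x xs ih =>
    simp only [List.length_cons] at h
    have ht : (t ++ [s.getD x d]).take m = t ++ [s.getD x d] :=
      List.take_of_length_le (by simp; omega)
    have := ih (t ++ [s.getD x d]) (by simp; omega)
    simp only [visitAll, addValue, setReg, set_getD_self, ht, this]
    simp

theorem visitAll_writeValue [DecidableEq Q] (R : Rule Q k m) (rs : List Q) (xs : List ℕ)
    (h : rs.length = xs.length) (hm : rs.length ≤ m) (i : Fin (k + 1)) (c : Bool) (e : σ)
    (s : List Q) :
    visitAll R.top (writeValue R) xs (⟨none, i, ⟨rs, hm⟩, c, e⟩ : Control Q σ k m) s =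
      (⟨none, i, ⟨[], by simp⟩, (R.write rs xs (c, s)).1, e⟩, (R.write rs xs (c, s)).2) := by
  induction rs generalizing xs c s with
  | nil =>
    cases xs with
    | nil => rfl
    | cons => cases h
  | cons r rs ih =>
    cases xs with
    | nil => cases h
    | cons x xs =>
      simp only [List.length_cons] at h hm
      exact ih xs (by omega) (by omega) _ _

theorem visitAll_id (d : Q) (xs : List ℕ) (v : Control Q σ k m) (hv : v.reg = none) (s : List Q) :
    visitAll d (fun v q => (v, q)) xs v s = (v, s) := by
  induction xs with
  | nil => rfl
  | cons x xs ih =>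
    have hv' : v.setReg none = v := by rw [← hv]; rfl
    simp only [visitAll, set_getD_self, hv', ih]

theorem length_nums_le {n : ℕ} {xs : List ℕ} (h : ∀ x ∈ xs, x < n) :
    (nums xs : List (Bool ⊕ Q)).length ≤ xs.length * n := by
  induction xs with
  | nil => simp [nums]
  | cons x xs ih =>
    have h1 := ih fun y hy => h y (by simp [hy])
    have h2 := h x (by simp)
    simp only [nums, List.flatMap_cons, List.length_append, length_num, List.length_cons] at h1 ⊢
    rw [Nat.add_mul]
    omega

variable [DecidableEq K]

section Runs

variable {M D N T X O : List (Bool ⊕ Q)} {S : ∀ i, List (Γ i)}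

theorem runs_readIndex (i : Fin (k + 1)) (j : Fin (k + 1)) (t : {l : List Q // l.length ≤ m})
    (c : Bool) (e : σ) :
    Runs (readIndex k m Γ σ) ⟨(num i ++ M).head?, j, t, c, e⟩
      (layout (num i ++ M).tail D N T X O S) ⟨none, i, ⟨[], by simp⟩, c, e⟩
      (layout M ((num i).reverse ++ D) N T X O S) (2 * k + 3) := by
  -- Here `r` ones have been counted already and `a` are still to come.
  have walk : ∀ (a r : ℕ) (D : List (Bool ⊕ Q)),
      Runs (.loop isOne <| .prim <| .push (.inl .done) (fun _ => .inl true) <|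
        .load (fun v => { v with idx := Fin.ofNat (k + 1) (v.idx + 1) }) <|
          .pop (.inl .inp) (fun v x => v.setReg x) .halt)
        (⟨(num a ++ M).head?, Fin.ofNat (k + 1) r, ⟨[], by simp⟩, c, e⟩ : Control Q σ k m)
        (layout (num a ++ M).tail D N T X O S)
        ⟨some (.inl false), Fin.ofNat (k + 1) (r + a), ⟨[], by simp⟩, c, e⟩
        (layout M (List.replicate a (.inl true) ++ D) N T X O S) (2 * a + 1) := by
    intro a
    induction a with
    | zero => exact fun r D => .loop_false rfl
    | succ a ih =>
      intro r D
      have h := ih (r + 1) (.inl true :: D)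
      rw [List.append_cons _ (.inl true) D, ← List.replicate_succ', Nat.add_assoc,
        Nat.add_comm 1 a] at h
      refine (Runs.loop_true rfl (.prim ?_) h).mono (by omega)
      simp only [TM2.stepAux, update_layout_done, update_layout_inp, setReg]
      simp [layout, num_succ, Fin.ofNat]
  have h := walk i 0 D
  rw [Nat.zero_add] at h
  refine ((Runs.prim rfl).seq (h.seq (.prim ?_))).mono (n := 2 * k + 3) (by omega)
  simp [update_layout_done, layout, setReg, num, CSP.encodeNat]

theorem runs_popReg_inp {v : Control Q σ k m} :
    Runs (popReg Γ σ k m .inp) v (layout M D N T X O S) (v.setReg M.head?)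
      (layout M.tail D N T X O S) 1 := by
  have h := runs_popReg (a := .inp) (v := v) (S := layout M D N T X O S)
  rwa [update_layout_inp] at h

theorem runs_moveTape_scope_inp {v : Control Q σ k m} :
    Runs (moveTape Γ σ k m .scope .inp) v (layout M D N T X O S) (v.setReg none)
      (layout (N.reverse ++ M) D [] T X O S) (2 * N.length + 2) := by
  have h := runs_moveAll (a := .inl .scope) (b := .inl .inp) (by simp)
    (φ := fun x => x) (ψ := fun x => x) (v := v) (S := layout M D N T X O S)
  rw [update_layout_scope, update_layout_inp, List.map_id'] at h
  exact h

theorem runs_moveTape_done_inp {v : Control Q σ k m} :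
    Runs (moveTape Γ σ k m .done .inp) v (layout M D N T X O S) (v.setReg none)
      (layout (D.reverse ++ M) [] N T X O S) (2 * D.length + 2) := by
  have h := runs_moveAll (a := .inl .done) (b := .inl .inp) (by simp)
    (φ := fun x => x) (ψ := fun x => x) (v := v) (S := layout M D N T X O S)
  rw [update_layout_done, update_layout_inp, List.map_id'] at h
  exact h

variable {n : ℕ} {s : List Q} {xs : List ℕ}

theorem runs_read_scope (d : Q) (hs : s.length = n) (hxs : ∀ x ∈ xs, x < n) (hm : xs.length ≤ m)
    {r : ℕ} (hr : xs.length = r) (i : Fin (k + 1)) (c : Bool) (e : σ) :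
    Runs ((visit Γ .scope addValue).rep r) ⟨none, i, ⟨[], by simp⟩, c, e⟩
      (layout (nums xs ++ M) D [] (s.map .inr) [] O S)
      ⟨none, i, ⟨xs.map fun x => s.getD x d, by simpa using hm⟩, c, e⟩
      (layout M D (nums xs).reverse (s.map .inr) [] O S) (m * (4 * n + 5) + 1) := by
  have h := runs_rep_visit (S := layout M D [] (s.map .inr) [] O S) (b := .scope)
    (by simp [Tape.IsTarget]) d (v := (⟨none, i, ⟨[], by simp⟩, c, e⟩ : Control Q σ k m)) rfl
    (u := addValue) (D := []) (M := M) hs hxs hr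
  rw [frame_scope, frame_scope, List.append_nil,
    visitAll_addValue d xs i [] c e s (by simpa using hm)] at h
  exact h.mono (by subst hr; gcongr)

variable [DecidableEq Q] (R : Rule Q k m)

/-- A bound for the time spent on one constraint. -/
def stepTime (k m n : ℕ) : ℕ :=
  2 * k + 13 + 10 * m * n + 10 * m

/-- The scope is read twice. The first reading collects the values and parks the scope on its own
stack; after the update it is returned to the input, and the second reading writes the proposed
values into the table. -/
theorem runs_stepProg {c : Fin (k + 1) × List ℕ} (hc : R.Valid n c) (hs : s.length = n)
    (j : Fin (k + 1)) (t : {l : List Q // l.length ≤ m}) (b : Bool) (e : σ) :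
    ∃ j' t', Runs (stepProg Γ σ R) ⟨(word c ++ M).head?, j, t, b, e⟩
      (layout (word c ++ M).tail D [] (s.map .inr) [] O S)
      ⟨M.head?, j', t', (R.step (b, s) c).1, e⟩
      (layout M.tail ((word c).reverse ++ D) [] ((R.step (b, s) c).2.map .inr) [] O S)
      (stepTime k m n) := by
  obtain ⟨i, xs⟩ := c
  obtain ⟨hl, hxs⟩ := hc
  simp only at hl hxs
  have hm : xs.length ≤ m := hl ▸ R.arity_le i
  have hu := R.length_update i (R.look s xs) (by simpa [Rule.look] using hl)
  have hu' : (R.update i (R.look s xs)).take m = R.update i (R.look s xs) :=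
    List.take_of_length_le (hu ▸ R.arity_le i)
  have h1 := runs_readIndex (Γ := Γ) (m := m) (M := nums xs ++ M) (D := D) (N := [])
    (T := s.map .inr) (X := []) (O := O) (S := S) i j t b e
  have h2 := runs_read_scope (Γ := Γ) (k := k) (M := M) (D := (num i).reverse ++ D) (O := O)
    (S := S) R.top hs hxs hm hl i b e
  have h3 : Runs (.prim (.load (fun v => { v with
      tup := ⟨(R.update v.idx v.tup.1).take m, by simp⟩ }) .halt))
      (⟨none, i, ⟨xs.map fun x => s.getD x R.top, by simpa using hm⟩, b, e⟩ : Control Q σ k m)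
      (layout M ((num i).reverse ++ D) (nums xs).reverse (s.map .inr) [] O S)
      (⟨none, i, ⟨R.update i (R.look s xs), hu ▸ R.arity_le i⟩, b, e⟩ : Control Q σ k m)
      (layout M ((num i).reverse ++ D) (nums xs).reverse (s.map .inr) [] O S) 1 := by
    refine .prim ?_
    simp only [TM2.stepAux]
    congr 3
  have h4 := runs_moveTape_scope_inp (Γ := Γ) (M := M) (D := (num i).reverse ++ D)
    (N := (nums xs).reverse) (T := s.map .inr) (X := []) (O := O) (S := S)
    (v := (⟨none, i, ⟨R.update i (R.look s xs), hu ▸ R.arity_le i⟩, b, e⟩ : Control Q σ k m))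
  have h5 := runs_rep_visit (S := layout M D [] (s.map .inr) [] O S) (b := .done)
    (by simp [Tape.IsTarget]) R.top
    (v := (⟨none, i, ⟨R.update i (R.look s xs), hu ▸ R.arity_le i⟩, b, e⟩ : Control Q σ k m)) rfl
    (u := writeValue R) (D := (num i).reverse ++ D) (M := M) hs hxs hl
  rw [frame_done, frame_done, visitAll_writeValue R _ _ (hu.trans hl.symm)] at h5
  rw [List.reverse_reverse] at h4
  have h6 := Runs.switch (sel := Control.idx)
    (v := (⟨none, i, ⟨[], by simp⟩, b, e⟩ : Control Q σ k m))
    (P := fun i => ((visit Γ .scope addValue).rep (R.arity i)).seq <|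
        (Prog.prim (.load (fun v => { v with
          tup := ⟨(R.update v.idx v.tup.1).take m, by simp⟩ }) .halt)).seq <|
        (moveTape Γ σ k m .scope .inp).seq <|
          (visit Γ .done (writeValue R)).rep (R.arity i)) (h2.seq (h3.seq (h4.seq h5)))
  have h7 := h1.seq (h6.seq runs_popReg_inp)
  refine ⟨i, ⟨[], by simp⟩, ?_⟩
  simp only [word, List.append_assoc, List.reverse_append]
  refine h7.mono ?_
  have h8 := length_nums_le (Q := Q) hxs
  have h9 : xs.length * n ≤ m * n := Nat.mul_le_mul_right n hm
  have h10 : R.arity i * (4 * n + 5) ≤ m * (4 * n + 5) :=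
    Nat.mul_le_mul_right _ (R.arity_le i)
  rw [List.length_reverse]
  unfold stepTime
  nlinarith

end Runs

end StackProgram

/-! ### Running the refinement to its fixed point and writing the result. -/

namespace StackProgram

open Turing Function Control

variable {Q : Type} {k m : ℕ} {K : Type} {Γ : K → Type} {σ : Type} [DecidableEq K]
  {M D N T X O : List (Bool ⊕ Q)} {S : ∀ i, List (Γ i)} {n : ℕ}

/-- Words of constraints are non-empty, so an empty register signals the end of the list; this is
the test of the loops over constraints. -/
theorem isSome_head?_word (c : Fin (k + 1) × List ℕ) :
    (word c ++ M).head?.isSome = true := by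
  cases h : (c.1 : ℕ) <;> simp [word, h, num_zero, num_succ]

theorem words_cons (c : Fin (k + 1) × List ℕ) (C : List (Fin (k + 1) × List ℕ)) :
    (words (c :: C) : List (Bool ⊕ Q)) = word c ++ words C :=
  List.flatMap_cons

/-- A bound for the time spent on all constraints. -/
def passTime (k m n c w : ℕ) : ℕ :=
  c * (stepTime k m n + 1) + 2 * w + 5

section Refine

variable [DecidableEq Q] (R : Rule Q k m)

theorem runs_passProg {C : List (Fin (k + 1) × List ℕ)} (hC : ∀ c ∈ C, R.Valid n c) {s : List Q}
    (hs : s.length = n) (v : Control Q σ k m) :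
    ∃ v', v'.changed = (R.pass C s).1 ∧ v'.emb = v.emb ∧
      Runs (passProg Γ σ R) v (layout (words C) [] [] (s.map .inr) [] O S) v'
        (layout (words C) [] [] ((R.pass C s).2.map .inr) [] O S)
        (passTime k m n C.length (words C : List (Bool ⊕ Q)).length) := by
  have main : ∀ (C : List (Fin (k + 1) × List ℕ)) (_ : ∀ c ∈ C, R.Valid n c) (j : Fin (k + 1))
      (t : {l : List Q // l.length ≤ m}) (p : Bool × List Q) (_ : p.2.length = n)
      (D : List (Bool ⊕ Q)),
      ∃ j' t', Runs (.loop (fun v => v.reg.isSome) (stepProg Γ σ R))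
        (⟨(words C).head?, j, t, p.1, v.emb⟩ : Control Q σ k m)
        (layout (words C).tail D [] (p.2.map .inr) [] O S)
        ⟨none, j', t', (C.foldl R.step p).1, v.emb⟩
        (layout [] ((words C).reverse ++ D) [] ((C.foldl R.step p).2.map .inr) [] O S)
        (C.length * (stepTime k m n + 1) + 1) := by
    intro C hC
    induction C with
    | nil => exact fun j t p _ D => ⟨j, t, Runs.mono (.loop_false rfl) (by omega)⟩
    | cons c C ih =>
      intro j t p hp D
      obtain ⟨j₁, t₁, h1⟩ := runs_stepProg (Γ := Γ) (M := words C) (D := D) (O := O) (S := S) R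
        (hC c (by simp)) hp j t p.1 v.emb
      obtain ⟨j₂, t₂, h2⟩ := ih (fun c hc => hC c (by simp [hc])) j₁ t₁ (R.step p c)
        (by rw [R.length_step, hp]) ((word c).reverse ++ D)
      refine ⟨j₂, t₂, ?_⟩
      rw [words_cons, List.reverse_append, List.append_assoc, List.foldl_cons]
      refine (Runs.loop_true (p := fun v => v.reg.isSome) (by exact isSome_head?_word c) h1 h2).mono ?_
      rw [List.length_cons, Nat.add_mul]
      omega
  obtain ⟨j, t, h⟩ := main C hC v.idx v.tup (false, s) hs []
  rw [List.append_nil] at h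
  have h1 : Runs (.prim (.load (fun v => { v with changed := false }) .halt)) v
      (layout (words C) [] [] (s.map .inr) [] O S) { v with changed := false }
      (layout (words C) [] [] (s.map .inr) [] O S) 1 := .prim rfl
  have h2 := runs_moveTape_done_inp (Γ := Γ) (M := []) (D := (words C).reverse) (N := [])
    (T := (R.pass C s).2.map .inr) (X := []) (O := O) (S := S)
    (v := (⟨none, j, t, (R.pass C s).1, v.emb⟩ : Control Q σ k m))
  rw [List.reverse_reverse, List.append_nil] at h2
  refine ⟨_, ?_, ?_, (h1.seq (runs_popReg_inp.seq (h.seq h2))).mono ?_⟩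
  · rfl
  · rfl
  · rw [List.length_reverse, passTime]
    omega

/-- The potential `μ` falls by at least one in every pass that raises the flag, so there are at most
`μ s + 1` passes. Here `r` counts the passes before the last one, which leaves the flag down. -/
theorem runs_fixProg {C : List (Fin (k + 1) × List ℕ)} (hC : ∀ c ∈ C, R.Valid n c)
    {μ : List Q → ℕ} (hμ : ∀ s, s.length = n → μ (R.pass C s).2 + (R.pass C s).1.toNat ≤ μ s)
    {s : List Q} (hs : s.length = n) (v : Control Q σ k m) :
    ∃ (r : ℕ) (v' : Control Q σ k m),
      (R.pass C ((fun s => (R.pass C s).2)^[r] s)).1 = false ∧ v'.emb = v.emb ∧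
      Runs (fixProg Γ σ R) v (layout (words C) [] [] (s.map .inr) [] O S) v'
        (layout (words C) [] []
          ((R.pass C ((fun s => (R.pass C s).2)^[r] s)).2.map .inr) [] O S)
        ((μ s + 1) * (passTime k m n C.length (words C : List (Bool ⊕ Q)).length + 1) + 2) := by
  have main : ∀ (a : ℕ) (s : List Q) (_ : s.length = n) (_ : μ s ≤ a) (w : Control Q σ k m)
      (_ : w.changed = true) (_ : w.emb = v.emb),
      ∃ (r : ℕ) (v' : Control Q σ k m),
        (R.pass C ((fun s => (R.pass C s).2)^[r] s)).1 = false ∧ v'.emb = v.emb ∧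
        Runs (.loop Control.changed (passProg Γ σ R)) w
          (layout (words C) [] [] (s.map .inr) [] O S) v'
          (layout (words C) [] []
            ((R.pass C ((fun s => (R.pass C s).2)^[r] s)).2.map .inr) [] O S)
          ((a + 1) * (passTime k m n C.length (words C : List (Bool ⊕ Q)).length + 1) + 1) := by
    intro a
    induction a with
    | zero =>
      intro s hs ha w hw hw'
      obtain ⟨v', h1, h2, h3⟩ := runs_passProg (Γ := Γ) (O := O) (S := S) R hC hs w
      have h4 := hμ s hs
      have h5 : (R.pass C s).1 = false := by
        cases h : (R.pass C s).1
        · rfl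
        · rw [h, Bool.toNat_true] at h4; omega
      refine ⟨0, v', h5, h2.trans hw', ?_⟩
      exact (Runs.loop_true hw h3 (.loop_false (h1.trans h5))).mono (by omega)
    | succ a ih =>
      intro s hs ha w hw hw'
      obtain ⟨v', h1, h2, h3⟩ := runs_passProg (Γ := Γ) (O := O) (S := S) R hC hs w
      have h4 := hμ s hs
      cases h5 : (R.pass C s).1
      · refine ⟨0, v', h5, h2.trans hw', ?_⟩
        refine (Runs.loop_true hw h3 (.loop_false (h1.trans h5))).mono ?_
        rw [Nat.add_mul]
        omega
      · rw [h5, Bool.toNat_true] at h4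
        obtain ⟨r, v'', h6, h7, h8⟩ := ih (R.pass C s).2 (by rw [R.length_pass, hs]) (by omega) v'
          (h1.trans h5) (h2.trans hw')
        refine ⟨r + 1, v'', h6, h7, (Runs.loop_true hw h3 h8).mono ?_⟩
        rw [Nat.add_mul (a + 1)]
        omega
  obtain ⟨r, v', h1, h2, h3⟩ := main (μ s) s hs le_rfl { v with changed := true } rfl rfl
  exact ⟨r, v', h1, h2, ((Runs.prim rfl).seq h3).mono (by omega)⟩

end Refine

section Output

variable (R : Rule Q k m)

/-- The output word of a constraint over the table `s`. -/
def outWord (s : List Q) (c : Fin (k + 1) × List ℕ) : List (Bool ⊕ Q) :=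
  num (R.code c.1 (R.look s c.2)) ++ nums c.2

theorem runs_rep_push (a : ℕ) (v : Control Q σ k m) :
    Runs ((Prog.prim (.push (.inl .out) (fun _ => .inl true) .halt)).rep a) v
      (layout M D N T X O S) v (layout M D N T X (List.replicate a (.inl true) ++ O) S)
      (a + 1) := by
  induction a generalizing O with
  | zero => exact Runs.rep_zero
  | succ a ih =>
    have h := ih (O := .inl true :: O)
    rw [List.append_cons _ (.inl true) O, ← List.replicate_succ'] at h
    refine (Runs.rep_succ (.prim ?_) h).mono (by omega)
    simp only [TM2.stepAux, update_layout_out]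
    rfl

/-- A bound for the time needed to put out a constraint. -/
def outStepTime (k m n a : ℕ) : ℕ :=
  2 * k + 15 + 10 * m * n + 10 * m + a

variable [Finite Q] [Finite σ]

theorem runs_outStepProg {a : ℕ} (ha : ∀ i l, R.code i l ≤ a) {c : Fin (k + 1) × List ℕ}
    (hc : R.Valid n c) {s : List Q} (hs : s.length = n) (j : Fin (k + 1))
    (t : {l : List Q // l.length ≤ m}) (b : Bool) (e : σ) :
    ∃ j' t', Runs (outStepProg Γ R) ⟨(word c ++ M).head?, j, t, b, e⟩
      (layout (word c ++ M).tail D [] (s.map .inr) [] O S) ⟨M.head?, j', t', b, e⟩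
      (layout M.tail ((num c.1).reverse ++ D) [] (s.map .inr) [] ((outWord R s c).reverse ++ O) S)
      (outStepTime k m n a) := by
  obtain ⟨i, xs⟩ := c
  obtain ⟨hl, hxs⟩ := hc
  simp only at hl hxs
  have hm : xs.length ≤ m := hl ▸ R.arity_le i
  have h1 := runs_readIndex (Γ := Γ) (m := m) (M := nums xs ++ M) (D := D) (N := [])
    (T := s.map .inr) (X := []) (O := O) (S := S) i j t b e
  have h2 := runs_read_scope (Γ := Γ) (k := k) (M := M) (D := (num i).reverse ++ D) (O := O)
    (S := S) R.top hs hxs hm hl i b e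
  set w : Control Q σ k m := ⟨none, i, ⟨xs.map fun x => s.getD x R.top, by simpa using hm⟩, b, e⟩
    with hw
  have h3 := runs_moveTape_scope_inp (Γ := Γ) (M := M) (D := (num i).reverse ++ D)
    (N := (nums xs).reverse) (T := s.map .inr) (X := []) (O := O) (S := S) (v := w)
  rw [List.reverse_reverse] at h3
  have h4 : Runs (.switch (fun v : Control Q σ k m => v) fun v =>
      ((Prog.prim (.push (.inl .out) (fun _ => .inl true) .halt)).rep
        (R.code v.idx v.tup.1)).seq <| .prim (.push (.inl .out) (fun _ => .inl false) .halt)) w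
      (layout (nums xs ++ M) ((num i).reverse ++ D) [] (s.map .inr) [] O S) w
      (layout (nums xs ++ M) ((num i).reverse ++ D) [] (s.map .inr) []
        ((num (R.code i (R.look s xs))).reverse ++ O) S) (a + 3) := by
    refine (Runs.switch ((runs_rep_push _ w).seq (.prim ?_))).mono (m := R.code i (R.look s xs) + 3)
      (by have := ha i (R.look s xs); omega)
    simp [update_layout_out, num, CSP.encodeNat, layout, hw, Rule.look]
  have h5 := runs_rep_visit (S := layout M ((num i).reverse ++ D) [] (s.map .inr) [] O S)
    (b := .out) (by simp [Tape.IsTarget]) R.top (v := w) rfl (u := fun v q => (v, q))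
    (D := (num (R.code i (R.look s xs))).reverse ++ O) (M := M) hs hxs hl
  rw [frame_out, frame_out, visitAll_id _ _ _ rfl] at h5
  have h6 := Runs.switch (sel := Control.idx)
    (v := (⟨none, i, ⟨[], by simp⟩, b, e⟩ : Control Q σ k m))
    (P := fun i => ((visit Γ .scope addValue).rep (R.arity i)).seq <|
        (moveTape Γ σ k m .scope .inp).seq <|
        (Prog.switch (fun v => v) fun v =>
          ((Prog.prim (.push (.inl .out) (fun _ => .inl true) .halt)).rep
            (R.code v.idx v.tup.1)).seq <|
            .prim (.push (.inl .out) (fun _ => .inl false) .halt)).seq <|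
          (visit Γ .out fun v q => (v, q)).rep (R.arity i)) (h2.seq (h3.seq (h4.seq h5)))
  have h7 := h1.seq (h6.seq runs_popReg_inp)
  refine ⟨i, w.tup, ?_⟩
  simp only [word, outWord, List.append_assoc, List.reverse_append]
  refine h7.mono ?_
  have h8 := length_nums_le (Q := Q) hxs
  have h9 : xs.length * n ≤ m * n := Nat.mul_le_mul_right n hm
  have h10 : R.arity i * (4 * n + 5) ≤ m * (4 * n + 5) :=
    Nat.mul_le_mul_right _ (R.arity_le i)
  rw [List.length_reverse]
  unfold outStepTime
  nlinarith

/-- The scopes travel to the output, so only the old relation symbols pile up as `D`. Their content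
is irrelevant; the length bound serves to time the later clearing. -/
theorem runs_outProg {a : ℕ} (ha : ∀ i l, R.code i l ≤ a) {C : List (Fin (k + 1) × List ℕ)}
    (hC : ∀ c ∈ C, R.Valid n c) {s : List Q} (hs : s.length = n) (v : Control Q σ k m) :
    ∃ (v' : Control Q σ k m) (D : List (Bool ⊕ Q)),
      v'.emb = v.emb ∧ D.length ≤ C.length * (k + 1) ∧
      Runs (outProg Γ R) v (layout (words C) [] [] (s.map .inr) [] O S) v'
        (layout [] D [] (s.map .inr) [] ((C.flatMap (outWord R s)).reverse ++ O) S)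
        (C.length * (outStepTime k m n a + 1) + 2) := by
  have main : ∀ (C : List (Fin (k + 1) × List ℕ)) (_ : ∀ c ∈ C, R.Valid n c)
      (w : Control Q σ k m) (_ : w.emb = v.emb) (D O : List (Bool ⊕ Q)),
      ∃ (v' : Control Q σ k m) (D' : List (Bool ⊕ Q)),
        v'.emb = v.emb ∧ D'.length ≤ D.length + C.length * (k + 1) ∧
        Runs (.loop (fun v => v.reg.isSome) (outStepProg Γ R)) (w.setReg (words C).head?)
          (layout (words C).tail D [] (s.map .inr) [] O S) v'
          (layout [] D' [] (s.map .inr) [] ((C.flatMap (outWord R s)).reverse ++ O) S)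
          (C.length * (outStepTime k m n a + 1) + 1) := by
    intro C hC
    induction C with
    | nil => exact fun w hw D O => ⟨w.setReg none, D, hw, by simp, Runs.mono (.loop_false rfl) (by omega)⟩
    | cons c C ih =>
      intro w hw D O
      obtain ⟨j, t, h1⟩ := runs_outStepProg (Γ := Γ) (M := words C) (D := D) (O := O) (S := S) R
        ha (hC c (by simp)) hs w.idx w.tup w.changed w.emb
      obtain ⟨v', D', h2, h3, h4⟩ := ih (fun c hc => hC c (by simp [hc]))
        ⟨none, j, t, w.changed, w.emb⟩ hw ((num c.1).reverse ++ D)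
        ((outWord R s c).reverse ++ O)
      refine ⟨v', D', h2, ?_, ?_⟩
      · rw [List.length_append, List.length_reverse, length_num] at h3
        rw [List.length_cons, Nat.add_mul]
        omega
      · rw [words_cons, List.flatMap_cons, List.reverse_append, List.append_assoc]
        refine (Runs.loop_true (p := fun v => v.reg.isSome) (by exact isSome_head?_word c) h1 h4).mono ?_
        rw [List.length_cons, Nat.add_mul]
        omega
  obtain ⟨v', D, h1, h2, h3⟩ := main C hC v rfl [] O
  exact ⟨v', D, h1, by simpa using h2, (runs_popReg_inp.seq h3).mono (by omega)⟩

end Output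

theorem runs_headerProg (R : Rule Q k m) (v : Control Q σ k m) :
    Runs (headerProg Γ σ R) v (layout (num n ++ M) D N [] X [] S)
      (v.setReg (some (.inl false)))
      (layout M D N ((List.replicate n R.top).map .inr) X (num n).reverse S) (2 * n + 3) := by
  have walk : ∀ (n : ℕ) (T O : List (Bool ⊕ Q)),
      Runs (.loop isOne <| .prim <| .push (.inl .out) (fun _ => .inl true) <|
          .push (.inl .table) (fun _ => .inr R.top) <|
            .pop (.inl .inp) (fun v x => v.setReg x) .halt)
        (v.setReg (num n ++ M).head?)
        (layout (num n ++ M).tail D N T X O S) (v.setReg (some (.inl false)))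
        (layout M D N (List.replicate n (.inr R.top) ++ T) X
          (List.replicate n (.inl true) ++ O) S) (2 * n + 1) := by
    intro n
    induction n with
    | zero => exact fun T O => .loop_false rfl
    | succ n ih =>
      intro T O
      have h := ih (.inr R.top :: T) (.inl true :: O)
      rw [List.append_cons _ _ T, List.append_cons _ _ O, ← List.replicate_succ',
        ← List.replicate_succ'] at h
      refine (Runs.loop_true rfl (.prim ?_) h).mono (by omega)
      simp only [TM2.stepAux, update_layout_out, update_layout_table, update_layout_inp]
      simp [layout, num_succ]
  refine (runs_popReg_inp.seq ((walk n [] []).seq (.prim ?_))).mono (n := 2 * n + 3) (by omega)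
  simp [update_layout_out, layout, num, CSP.encodeNat]

/-- A bound for the time needed to refine an instance with `n` variables and `c` constraints. -/
def refineTime (k m n c w a μ : ℕ) : ℕ :=
  2 * n + 3 + ((μ + 1) * (passTime k m n c w + 1) + 2) + (c * (outStepTime k m n a + 1) + 2) +
    (2 * (c * (k + 1)) + 2) + (2 * n + 2)

theorem runs_refineProg [DecidableEq Q] [Finite Q] [Finite σ] (R : Rule Q k m) {a : ℕ}
    (ha : ∀ i l, R.code i l ≤ a) {C : List (Fin (k + 1) × List ℕ)} (hC : ∀ c ∈ C, R.Valid n c)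
    {μ : List Q → ℕ} (hμ : ∀ s, s.length = n → μ (R.pass C s).2 + (R.pass C s).1.toNat ≤ μ s)
    (v : Control Q σ k m) :
    ∃ (r : ℕ) (v' : Control Q σ k m) (s : List Q),
      s = (fun s => (R.pass C s).2)^[r] (List.replicate n R.top) ∧
      (R.pass C s).1 = false ∧ v'.emb = v.emb ∧
      Runs (refineProg Γ R) v (layout (num n ++ words C) [] [] [] [] [] S) v'
        (layout [] [] [] [] []
          (num n ++ C.flatMap (outWord R (R.pass C s).2)).reverse S)
        (refineTime k m n C.length (words C : List (Bool ⊕ Q)).length a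
          (μ (List.replicate n R.top))) := by
  have h1 := runs_headerProg (Γ := Γ) (n := n) (M := words C) (D := []) (N := []) (X := [])
    (S := S) R v
  obtain ⟨r, v₁, h2, h3, h4⟩ := runs_fixProg (Γ := Γ) (O := (num n).reverse) (S := S) R hC hμ
    (s := List.replicate n R.top) (by simp) (v.setReg (some (.inl false)))
  set s := (fun s => (R.pass C s).2)^[r] (List.replicate n R.top) with hs
  have hlen : (R.pass C s).2.length = n := by
    rw [R.length_pass, hs]
    clear * -
    induction r with
    | zero => simp
    | succ r ih => rw [Function.iterate_succ_apply', R.length_pass, ih]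
  obtain ⟨v₂, D, h5, h6, h7⟩ := runs_outProg (Γ := Γ) (O := (num n).reverse) (S := S) R ha hC
    hlen v₁
  have h8 := runs_clear (a := .done) (v := v₂) (S := layout [] D []
    ((R.pass C s).2.map .inr) []
    ((C.flatMap (outWord R (R.pass C s).2)).reverse ++ (num n).reverse) S)
  rw [update_layout_done] at h8
  have h9 := runs_clear (a := .table) (v := v₂.setReg none) (S := layout [] [] []
    ((R.pass C s).2.map .inr) []
    ((C.flatMap (outWord R (R.pass C s).2)).reverse ++ (num n).reverse) S)
  rw [update_layout_table, ← List.reverse_append] at h9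
  refine ⟨r, (v₂.setReg none).setReg none, s, rfl, h2, h5.trans h3, ?_⟩
  rw [← List.reverse_append] at h7 h8
  refine (h1.seq (h4.seq (h7.seq (h8.seq h9)))).mono ?_
  simp only [layout, List.length_map, hlen, refineTime]
  omega

end StackProgram

/-! ### Termination, fixed points and invariants of the refinement. -/

namespace StackProgram

open Turing Function Control

namespace Rule

variable {Q : Type} {k m : ℕ} (R : Rule Q k m) [DecidableEq Q] {n : ℕ}

/-- A proper change lowers the rank of one entry by at least one, which pays for the flag; the flag
contributes at most one however many changes follow. -/
theorem sum_write_add_le {rank : Q → ℕ} (hrank : ∀ r q, R.meet r q ≠ q → rank (R.meet r q) < rank q)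
    (rs : List Q) (xs : List ℕ) (p : Bool × List Q) (hxs : ∀ x ∈ xs, x < p.2.length) :
    ((R.write rs xs p).2.map rank).sum + (R.write rs xs p).1.toNat ≤
      (p.2.map rank).sum + p.1.toNat := by
  induction rs generalizing xs p with
  | nil => simp [write]
  | cons r rs ih =>
    cases xs with
    | nil => simp [write]
    | cons x xs =>
      obtain ⟨b, s⟩ := p
      have hx : x < s.length := hxs x (by simp)
      refine (ih xs _ (fun y hy => by simpa using hxs y (by simp [hy]))).trans ?_
      simp only
      have hq : s.getD x R.top = s[x] := by simp [hx]
      rw [hq, List.map_set]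
      have h1 : ((s.map rank).set x (rank (R.meet r s[x]))).sum + rank s[x] =
          (s.map rank).sum + rank (R.meet r s[x]) := by
        have hsplit := List.take_append_drop x (s.map rank)
        rw [List.drop_eq_getElem_cons (by simpa using hx)] at hsplit
        rw [List.set_eq_take_append_cons_drop, if_pos (by simpa using hx)]
        conv_rhs => rw [← hsplit]
        simp only [List.sum_append, List.sum_cons, List.getElem_map]
        omega
      by_cases h : R.meet r s[x] = s[x]
      · rw [h] at h1 ⊢
        simp only [ne_eq, not_true_eq_false, decide_false, Bool.or_false]
        omega
      · have := hrank r _ h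
        have h2 := Bool.toNat_le (b || decide (R.meet r s[x] ≠ s[x]))
        omega

theorem sum_pass_add_le {rank : Q → ℕ} (hrank : ∀ r q, R.meet r q ≠ q → rank (R.meet r q) < rank q)
    {C : List (Fin (k + 1) × List ℕ)} (hC : ∀ c ∈ C, R.Valid n c) {s : List Q}
    (hs : s.length = n) :
    ((R.pass C s).2.map rank).sum + (R.pass C s).1.toNat ≤ (s.map rank).sum := by
  have main : ∀ p : Bool × List Q, p.2.length = n →
      ((C.foldl R.step p).2.map rank).sum + (C.foldl R.step p).1.toNat ≤
        (p.2.map rank).sum + p.1.toNat := by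
    induction C with
    | nil => exact fun p _ => le_rfl
    | cons c C ih =>
      intro p hp
      refine (ih (fun c hc => hC c (by simp [hc])) _ (by rw [length_step, hp])).trans ?_
      exact R.sum_write_add_le hrank _ _ _ (hp ▸ (hC c (by simp)).2)
  exact main (false, s) hs

/-- The flag is never lowered during writing. If it is down at the end, no single offer changed
anything, so all offers were compared with the same table. -/
theorem write_eq_of_not_changed {rs : List Q} {xs : List ℕ} {p : Bool × List Q}
    (h : (R.write rs xs p).1 = false) :
    R.write rs xs p = p ∧ ∀ y ∈ rs.zip xs, R.meet y.1 (p.2.getD y.2 R.top) = p.2.getD y.2 R.top := by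
  induction rs generalizing xs p with
  | nil => simp [write]
  | cons r rs ih =>
    cases xs with
    | nil => simp [write]
    | cons x xs =>
      obtain ⟨b, s⟩ := p
      obtain ⟨h1, h2⟩ := ih h
      have h3 := h
      rw [write, h1] at h3
      simp only [Bool.or_eq_false_iff, decide_eq_false_iff_not, not_not] at h3
      obtain ⟨rfl, h3⟩ := h3
      simp only [h3, set_getD_self, ne_eq, not_true_eq_false, decide_false, Bool.or_false] at h1 h2
      refine ⟨?_, ?_⟩
      · rw [write]
        simp only [h3, set_getD_self, ne_eq, not_true_eq_false, decide_false, Bool.or_false]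
        exact h1
      · intro y hy
        rw [List.zip_cons_cons, List.mem_cons] at hy
        rcases hy with rfl | hy
        · exact h3
        · exact h2 y hy

theorem pass_eq_of_not_changed {C : List (Fin (k + 1) × List ℕ)} {s : List Q}
    (h : (R.pass C s).1 = false) :
    (R.pass C s).2 = s ∧ ∀ c ∈ C, ∀ y ∈ (R.update c.1 (R.look s c.2)).zip c.2,
      R.meet y.1 (s.getD y.2 R.top) = s.getD y.2 R.top := by
  have main : ∀ p : Bool × List Q, (C.foldl R.step p).1 = false → C.foldl R.step p = p ∧
      ∀ c ∈ C, ∀ y ∈ (R.update c.1 (R.look p.2 c.2)).zip c.2,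
        R.meet y.1 (p.2.getD y.2 R.top) = p.2.getD y.2 R.top := by
    clear h
    induction C with
    | nil => simp
    | cons c C ih =>
      intro p hp
      obtain ⟨h1, h2⟩ := ih (R.step p c) hp
      rw [List.foldl_cons, h1] at hp
      obtain ⟨h3, h4⟩ := R.write_eq_of_not_changed hp
      have h5 : R.step p c = p := h3
      rw [h5] at h1 h2
      refine ⟨by rw [List.foldl_cons, h5, h1], fun c' hc' => ?_⟩
      rw [List.mem_cons] at hc'
      rcases hc' with rfl | hc'
      · exact h4
      · exact h2 c' hc'
  obtain ⟨h1, h2⟩ := main (false, s) h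
  exact ⟨congrArg Prod.snd h1, h2⟩

/-- Since `meet` returns one of its arguments, a property shared by the offered and the present
values survives without any closure assumption on `P`. -/
theorem write_induction (hmeet : ∀ r q, R.meet r q = r ∨ R.meet r q = q) {P : ℕ → Q → Prop}
    {rs : List Q} {xs : List ℕ} {p : Bool × List Q} (hrs : ∀ y ∈ rs.zip xs, P y.2 y.1)
    (hp : ∀ x < p.2.length, P x (p.2.getD x R.top)) :
    ∀ x < (R.write rs xs p).2.length, P x ((R.write rs xs p).2.getD x R.top) := by
  induction rs generalizing xs p with
  | nil => simpa [write] using hp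
  | cons r rs ih =>
    cases xs with
    | nil => simpa [write] using hp
    | cons z xs =>
      rw [write]
      refine ih (fun y hy => hrs y (by simp [hy])) fun x hx => ?_
      simp only [List.length_set] at hx
      by_cases h : z = x
      · subst h
        simp only [List.getD_eq_getElem?_getD, List.getElem?_set_self hx, Option.getD_some]
        rcases hmeet r (p.2[z]?.getD R.top) with h | h
        · rw [h]; exact hrs (r, z) (by simp)
        · rw [h]; simpa using hp z hx
      · simp only [List.getD_eq_getElem?_getD, List.getElem?_set_ne h]
        simpa using hp x hx

/-- This is the soundness principle of the refinement: taking for `P x q` that a fixed solution lies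
below `q` at `x` shows that no solution is lost. -/
theorem iterate_pass_induction (hmeet : ∀ r q, R.meet r q = r ∨ R.meet r q = q)
    {P : ℕ → Q → Prop} {C : List (Fin (k + 1) × List ℕ)}
    (hC : ∀ c ∈ C, ∀ s : List Q, s.length = n → (∀ x < n, P x (s.getD x R.top)) →
      ∀ y ∈ (R.update c.1 (R.look s c.2)).zip c.2, P y.2 y.1)
    (htop : ∀ x < n, P x R.top) (r : ℕ) :
    ((fun s => (R.pass C s).2)^[r] (List.replicate n R.top)).length = n ∧
    ∀ x < n, P x (((fun s => (R.pass C s).2)^[r] (List.replicate n R.top)).getD x R.top) := by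
  have fold : ∀ p : Bool × List Q, p.2.length = n → (∀ x < n, P x (p.2.getD x R.top)) →
      ∀ x < n, P x ((C.foldl R.step p).2.getD x R.top) := by
    induction C with
    | nil => exact fun p _ hp => hp
    | cons c C ih =>
      intro p hn hp
      have hn' : (R.step p c).2.length = n := by rw [length_step, hn]
      refine ih (fun c hc => hC c (by simp [hc])) (R.step p c) hn' ?_
      have := R.write_induction hmeet (p := p) (hC c (by simp) p.2 hn hp) (by rwa [hn])
      rw [length_write, hn] at this
      exact this
  induction r with
  | zero => exact ⟨by simp, fun x hx => by simpa [hx] using htop x hx⟩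
  | succ r ih =>
    rw [Function.iterate_succ_apply']
    exact ⟨by rw [length_pass, ih.1], fold (false, _) ih.1 ih.2⟩

end Rule

theorem eval_le_eval_of_le (p : Polynomial ℕ) {a b : ℕ} (h : a ≤ b) :
    p.eval a ≤ p.eval b := by
  rw [Polynomial.eval_eq_sum_range, Polynomial.eval_eq_sum_range]
  gcongr

theorem refineTime_mono {k m n n' c c' w w' a μ μ' : ℕ} (hn : n ≤ n') (hc : c ≤ c') (hw : w ≤ w')
    (hμ : μ ≤ μ') : refineTime k m n c w a μ ≤ refineTime k m n' c' w' a μ' := by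
  unfold refineTime passTime outStepTime stepTime
  gcongr

theorem exists_polynomial_refineTime (k m a ρ : ℕ) :
    ∃ p : Polynomial ℕ, ∀ N, p.eval N = refineTime k m N N N a (N * ρ) := by
  unfold refineTime passTime outStepTime stepTime
  open _root_.Polynomial in
  refine ⟨2 * X + 3 + ((X * C ρ + 1) * (X * (2 * C k + 13 + 10 * C m * X + 10 * C m + 1) +
    2 * X + 5 + 1) + 2) + (X * (2 * C k + 15 + 10 * C m * X + 10 * C m + C a + 1) + 2) +
    (2 * (X * (C k + 1)) + 2) + (2 * X + 2), fun N => ?_⟩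
  simp

theorem initList_stk (tm : FinTM2) (s : List (tm.Γ tm.k₀)) :
    (initList tm s).stk = update (fun _ => []) tm.k₀ s := by
  funext i
  by_cases h : i = tm.k₀
  · subst h; simp [initList]
  · simp [initList, h]

theorem haltList_stk (tm : FinTM2) (s : List (tm.Γ tm.k₁)) :
    (haltList tm s).stk = update (fun _ => []) tm.k₁ s := by
  funext i
  by_cases h : i = tm.k₁
  · subst h; simp [haltList]
  · simp [haltList, h]

/-! ### Composing the refinement with a machine for the target problem. -/

section Reduction

variable {Q : Type} {k m : ℕ}

/-- The machine `tm` as a program on a larger collection of stacks. -/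
def embedProg (Q : Type) (k m : ℕ) (tm : FinTM2) :
    Prog (Alphabet Q tm.Γ) (Control Q tm.σ k m) where
  Λ := tm.Λ
  fin := @Finite.of_fintype _ tm.ΛFin
  main := tm.main
  code l := embed (Γ := Alphabet Q tm.Γ) (e := .inr) Control.emb (fun v w => { v with emb := w })
    (tm.m l)

/-- The control state at the start. -/
def start (Q : Type) (k m : ℕ) {σ : Type} (e : σ) : Control Q σ k m :=
  ⟨none, 0, ⟨[], by simp⟩, false, e⟩

/-- Refines an instance and runs the machine `tm` on the result. -/
def reduceProg [DecidableEq Q] [Finite Q] (R : Rule Q k m) (tm : FinTM2) (φ : tm.Γ tm.k₀ ≃ Bool) :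
    Prog (Alphabet Q tm.Γ) (Control Q tm.σ k m) :=
  letI : Finite tm.σ := @Finite.of_fintype _ tm.σFin
  (moveAll tm.σ k m (.inr tm.k₀) (.inl .done) (fun x => .inl (φ x)) (fun x => x)).seq <|
    (moveTape tm.Γ tm.σ k m .done .inp).seq <|
    (refineProg tm.Γ R).seq <|
    (moveAll tm.σ k m (.inl .out) (.inr tm.k₀) (fun x => x)
      (fun x => φ.symm (x.elim id fun _ => false))).seq <|
    -- A halting configuration in the sense of `haltList` carries the initial control state, so the
    -- working components are reset before the embedded machine takes over.
    (Prog.prim (.load (fun v => start Q k m v.emb) .halt)).seq <|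
    embedProg Q k m tm

/-- The machine that runs the program `reduceProg`. -/
noncomputable def reduceMachine [DecidableEq Q] [Finite Q] (R : Rule Q k m) (tm : FinTM2) (φ : tm.Γ tm.k₀ ≃ Bool) : FinTM2 :=
  letI : Finite tm.σ := @Finite.of_fintype _ tm.σFin
  letI := tm.kFin
  { K := Tape ⊕ tm.K
    kDecidableEq := inferInstance
    kFin := inferInstance
    k₀ := .inr tm.k₀
    k₁ := .inr tm.k₁
    Γ := Alphabet Q tm.Γ
    Λ := (reduceProg R tm φ).Λ
    main := (reduceProg R tm φ).main
    ΛFin := Fintype.ofFinite _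
    σ := Control Q tm.σ k m
    initialState := start Q k m tm.initialState
    σFin := Fintype.ofFinite _
    Γk₀Fin := tm.Γk₀Fin
    m := (reduceProg R tm φ).code }

theorem runs_embedProg (tm : FinTM2) {l : List (tm.Γ tm.k₀)} {l' : List (tm.Γ tm.k₁)} {t : ℕ}
    (h : TM2OutputsInTime tm l (some l') t) :
    Runs (embedProg Q k m tm) (start Q k m tm.initialState)
      (layout [] [] [] [] [] [] (update (fun _ => []) tm.k₀ l)) (start Q k m tm.initialState)
      (layout [] [] [] [] [] [] (update (fun _ => []) tm.k₁ l')) t := by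
  have h1 : StepsTo tm.m t (initList tm l) (haltList tm l') :=
    (StepsTo.of_iterate h.evals_in_steps).mono h.steps_le_m
  obtain ⟨S', h2, h3, h4⟩ := StepsTo.embed (Γ := Alphabet Q tm.Γ) (e := .inr)
    (get := Control.emb (k := k) (m := m)) (set := fun v w => { v with emb := w })
    Sum.inr_injective (fun _ _ => rfl) (fun _ _ _ => rfl) (fun _ => rfl) h1
    (v := start Q k m tm.initialState)
    (S := layout [] [] [] [] [] [] (update (fun _ => []) tm.k₀ l)) rfl
    (by rw [initList_stk]; rfl)
  rw [haltList_stk] at h3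
  have h5 : S' = layout [] [] [] [] [] [] (update (fun _ => []) tm.k₁ l') := by
    funext i
    rcases i with a | i
    · rw [h2 (.inl a) (by simp)]
      cases a <;> rfl
    · exact congrFun h3 i
  rw [h5] at h4
  exact h4

theorem length_le_length_words (C : List (Fin (k + 1) × List ℕ)) :
    C.length ≤ (words C : List (Bool ⊕ Q)).length := by
  induction C with
  | nil => simp
  | cons c C ih =>
    rw [words_cons, List.length_append, List.length_cons, word, List.length_append, length_num]
    omega

theorem length_flatMap_outWord_le (R : Rule Q k m) {a : ℕ} (ha : ∀ i l, R.code i l ≤ a)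
    (s : List Q) (C : List (Fin (k + 1) × List ℕ)) :
    (C.flatMap (outWord R s)).length ≤ (words C : List (Bool ⊕ Q)).length + C.length * a := by
  induction C with
  | nil => simp
  | cons c C ih =>
    have := ha c.1 (R.look s c.2)
    rw [words_cons, List.flatMap_cons, List.length_append, List.length_append, List.length_cons,
      word, outWord, List.length_append, List.length_append, length_num, length_num, Nat.add_mul]
    omega

/-- The table `s` is fixed before the word `w'` is introduced: only once the refined instance is
known can the run of `tm` on its code be supplied. Each output constraint is longer than the input
one by at most `a`, whence the factor `a + 1` inside `p`. -/
theorem runs_reduceProg [DecidableEq Q] [Finite Q] (R : Rule Q k m) {a : ℕ} (ha : ∀ i l, R.code i l ≤ a) {rank : Q → ℕ}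
    (hrank : ∀ r q, R.meet r q ≠ q → rank (R.meet r q) < rank q) (tm : FinTM2)
    (φ : tm.Γ tm.k₀ ≃ Bool) {n : ℕ} {C : List (Fin (k + 1) × List ℕ)}
    (hC : ∀ c ∈ C, R.Valid n c) {w : List Bool}
    (hw : w.map (.inl : Bool → Bool ⊕ Q) = num n ++ words C) :
    ∃ (r : ℕ) (s : List Q), s = (fun s => (R.pass C s).2)^[r] (List.replicate n R.top) ∧
      (R.pass C s).1 = false ∧
      ∀ (w' : List Bool) (_ : w'.map .inl = num n ++ C.flatMap (outWord R (R.pass C s).2))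
        (l' : List (tm.Γ tm.k₁)) (p : Polynomial ℕ)
        (_ : TM2OutputsInTime tm (w'.map φ.symm) (some l') (p.eval w'.length)),
        Runs (reduceProg R tm φ) (start Q k m tm.initialState)
          (layout [] [] [] [] [] [] (update (fun _ => []) tm.k₀ (w.map φ.symm)))
          (start Q k m tm.initialState)
          (layout [] [] [] [] [] [] (update (fun _ => []) tm.k₁ l'))
          (4 * w.length + 7 +
            refineTime k m w.length w.length w.length a (w.length * rank R.top) +
            2 * (w.length * (a + 1)) + p.eval (w.length * (a + 1))) := by
  have : Finite tm.σ := @Finite.of_fintype _ tm.σFin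
  set v := start Q k m tm.initialState with hv
  have h1 : Runs (moveAll tm.σ k m (.inr tm.k₀) (.inl .done) (fun x => .inl (φ x)) (fun x => x)) v
      (layout [] [] [] [] [] [] (update (fun _ => []) tm.k₀ (w.map φ.symm))) (v.setReg none)
      (layout [] (w.map .inl).reverse [] [] [] [] (fun _ => [])) (2 * w.length + 2) := by
    have h := runs_moveAll (a := .inr tm.k₀) (b := .inl .done) (by simp)
      (φ := fun x => (.inl (φ x) : Bool ⊕ Q)) (ψ := fun x => x) (v := v)
      (S := layout [] [] [] [] [] [] (update (fun _ => []) tm.k₀ (w.map φ.symm)))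
    rw [update_layout_inr, update_layout_done] at h
    simpa [layout, Function.comp_def] using h
  have h2 := runs_moveTape_done_inp (Γ := tm.Γ) (M := []) (D := (w.map .inl).reverse) (N := [])
    (T := []) (X := []) (O := []) (S := fun _ => []) (v := v.setReg none)
  rw [List.reverse_reverse, List.append_nil, hw] at h2
  obtain ⟨r, v', s, hs, hs', hv', h3⟩ := runs_refineProg (Γ := tm.Γ) (S := fun _ => []) R ha hC
    (μ := fun s => (s.map rank).sum) (fun s hs => R.sum_pass_add_le hrank hC hs)
    ((v.setReg none).setReg none)
  refine ⟨r, s, hs, hs', fun w' hw' l' p h => ?_⟩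
  rw [← hw'] at h3
  have h4 : Runs (moveAll tm.σ k m (.inl .out) (.inr tm.k₀) (fun x => x)
      (fun x => φ.symm (x.elim id fun _ => false))) v'
      (layout [] [] [] [] [] (w'.map .inl).reverse (fun _ => [])) (v'.setReg none)
      (layout [] [] [] [] [] [] (update (fun _ => []) tm.k₀ (w'.map φ.symm)))
      (2 * w'.length + 2) := by
    have h := runs_moveAll (a := .inl .out) (b := .inr tm.k₀) (by simp)
      (φ := fun x => (x : Bool ⊕ Q)) (ψ := fun x => φ.symm (x.elim id fun _ => false)) (v := v')
      (S := layout [] [] [] [] [] (w'.map .inl).reverse (fun _ => []))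
    rw [update_layout_out, update_layout_inr] at h
    simpa [layout, Function.comp_def] using h
  have h5 : Runs (Γ := Alphabet Q tm.Γ) (.prim (.load (fun v => start Q k m v.emb) .halt)) (v'.setReg none)
      (layout [] [] [] [] [] [] (update (fun _ => []) tm.k₀ (w'.map φ.symm))) v
      (layout [] [] [] [] [] [] (update (fun _ => []) tm.k₀ (w'.map φ.symm))) 1 := by
    refine .prim ?_
    have : (v'.setReg none).emb = tm.initialState := hv'
    simp only [TM2.stepAux, this, hv]
  rw [hw] at h1
  have h6 := h1.seq (h2.seq (h3.seq (h4.seq (h5.seq (runs_embedProg tm h)))))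
  refine h6.mono ?_
  have hlen : w.length = n + 1 + (words C : List (Bool ⊕ Q)).length := by
    rw [← List.length_map (as := w) (.inl : Bool → Bool ⊕ Q), hw, List.length_append, length_num]
  have hC' := length_le_length_words (Q := Q) C
  have hlen' : w'.length ≤ w.length * (a + 1) := by
    rw [← List.length_map (as := w') (.inl : Bool → Bool ⊕ Q), hw', List.length_append, length_num,
      hlen, Nat.mul_add, Nat.mul_one]
    have h7 := length_flatMap_outWord_le R ha (R.pass C s).2 C
    have h8 : C.length * a ≤ (n + 1 + (words C : List (Bool ⊕ Q)).length) * a :=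
      Nat.mul_le_mul_right _ (by omega)
    omega
  have h9 := eval_le_eval_of_le p hlen'
  have h10 : refineTime k m n C.length (words C : List (Bool ⊕ Q)).length a
      (((List.replicate n R.top).map rank).sum) ≤
      refineTime k m w.length w.length w.length a (w.length * rank R.top) := by
    refine refineTime_mono (by omega) (by omega) (by omega) ?_
    simp only [List.map_replicate, List.sum_replicate, smul_eq_mul]
    -- The initial potential is `n` times the rank of `top`, and `n` is at most the length of the
    -- input.
    exact Nat.mul_le_mul_right _ (by omega)
  simp only [List.length_reverse, List.length_append, length_num]
  omega

theorem layout_eq_update {K : Type} [DecidableEq K] {Γ : K → Type} (i : K) (l : List (Γ i)) :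
    (layout [] [] [] [] [] [] (update (fun _ => []) i l) : ∀ j, List (Alphabet Q Γ j)) =
      update (β := fun j => List (Alphabet Q Γ j)) (fun _ => []) (.inr i) l := by
  rw [← update_layout_inr]
  congr 1
  funext j
  rcases j with b | j
  · cases b <;> rfl
  · rfl

/-- Refinement is a polynomial time reduction. -/
theorem inP_of_refine [DecidableEq Q] [Finite Q] {α β : Type} {encα : α → List Bool}
    {encβ : β → List Bool} {p : α → Prop} {q : β → Prop} (hq : CSP.InP encβ q) (R : Rule Q k m)
    {a : ℕ} (ha : ∀ i l, R.code i l ≤ a) {rank : Q → ℕ}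
    (hrank : ∀ r q, R.meet r q ≠ q → rank (R.meet r q) < rank q) (n : α → ℕ)
    (C : α → List (Fin (k + 1) × List ℕ)) (hC : ∀ x, ∀ c ∈ C x, R.Valid (n x) c)
    (henc : ∀ x, (encα x).map (.inl : Bool → Bool ⊕ Q) = num (n x) ++ words (C x))
    (h : ∀ x (r : ℕ) (s : List Q),
      s = (fun s => (R.pass (C x) s).2)^[r] (List.replicate (n x) R.top) →
      (R.pass (C x) s).1 = false →
      ∃ y, (encβ y).map .inl = num (n x) ++ (C x).flatMap (outWord R s) ∧ (p x ↔ q y)) :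
    CSP.InP encα p := by
  obtain ⟨f, hf, ⟨M⟩⟩ := hq
  choose r s hs hs' hrun using fun x =>
    runs_reduceProg R ha hrank M.tm M.inputAlphabet (hC x) (henc x)
  choose y hy hpq using fun x => h x (r x) (s x) (hs x) (hs' x)
  obtain ⟨time, htime⟩ := exists_polynomial_refineTime k m a (rank R.top)
  have hrun' : ∀ x, Runs (reduceProg R M.tm M.inputAlphabet) (start Q k m M.tm.initialState)
      (layout [] [] [] [] [] []
        (update (fun _ => []) M.tm.k₀ ((encα x).map M.inputAlphabet.symm)))
      (start Q k m M.tm.initialState)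
      (layout [] [] [] [] [] [] (update (fun _ => []) M.tm.k₁
        ((Computability.encodeBool (f (y x))).map M.outputAlphabet.invFun)))
      ((4 * Polynomial.X + 7 + time + 2 * (Polynomial.X * (Polynomial.C a + 1)) +
        M.time.comp (Polynomial.X * (Polynomial.C a + 1))).eval (encα x).length) := by
    intro x
    have h1 := hrun x (encβ (y x))
      (by rw [(R.pass_eq_of_not_changed (hs' x)).1]; exact hy x) _ M.time (M.outputsFun (y x))
    refine h1.mono (le_of_eq ?_)
    simp [htime]
  refine ⟨fun x => f (y x), fun x => (hf _).trans (hpq x).symm,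
    ⟨{ tm := reduceMachine R M.tm M.inputAlphabet
       inputAlphabet := M.inputAlphabet
       outputAlphabet := M.outputAlphabet
       time := 4 * Polynomial.X + 7 + time + 2 * (Polynomial.X * (Polynomial.C a + 1)) +
        M.time.comp (Polynomial.X * (Polynomial.C a + 1))
       outputsFun := fun x => ?_ }⟩⟩
  have h2 : ∃ r ≤ _, _ := (hrun' x).exists_iterate
  refine Classical.choice ?_
  obtain ⟨t, ht, h2⟩ := h2
  refine ⟨⟨⟨t, ?_⟩, ht⟩⟩
  have hinit : initList (reduceMachine R M.tm M.inputAlphabet)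
      ((encα x).map M.inputAlphabet.symm) =
      ⟨some (reduceProg R M.tm M.inputAlphabet).main, start Q k m M.tm.initialState,
        layout [] [] [] [] [] []
        (update (fun _ => []) M.tm.k₀ ((encα x).map M.inputAlphabet.symm))⟩ := by
    have := initList_stk (reduceMachine R M.tm M.inputAlphabet)
      ((encα x).map M.inputAlphabet.symm)
    rw [layout_eq_update]
    exact congrArg (TM2.Cfg.mk _ _) this
  have hhalt : haltList (reduceMachine R M.tm M.inputAlphabet)
      ((Computability.encodeBool (f (y x))).map M.outputAlphabet.invFun) =
      ⟨none, start Q k m M.tm.initialState,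
        layout [] [] [] [] [] [] (update (fun _ => []) M.tm.k₁
        ((Computability.encodeBool (f (y x))).map M.outputAlphabet.invFun))⟩ := by
    have := haltList_stk (reduceMachine R M.tm M.inputAlphabet)
      ((Computability.encodeBool (f (y x))).map M.outputAlphabet.invFun)
    rw [layout_eq_update]
    exact congrArg (TM2.Cfg.mk _ _) this
  exact (congrArg (fun c => (flip bind (TM2.step (reduceProg R M.tm M.inputAlphabet).code))^[t]
    (some c)) hinit).trans (h2.trans (congrArg some hhalt).symm)

end Reduction

end StackProgram

/-! ### Refining instances of the constraint satisfaction problem -/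

namespace CSP

open StackProgram

variable {Q : Type} {k : ℕ} {ar : Fin k → ℕ}

/-- The rule that is given by an operation `upd i` on tuples of values for every relation symbol,
and by a numbering `e` of the relation symbols with a tuple of values. -/
def refineRule (ar : Fin k → ℕ) (upd : ∀ i, (Fin (ar i) → Q) → Fin (ar i) → Q) (meet : Q → Q → Q)
    (top : Q) {k' : ℕ} (e : (Σ i, Fin (ar i) → Q) ≃ Fin k') : Rule Q k (∑ i, ar i) where
  -- The index `k` only serves to make the index type non-empty; it gets the default arity `0` and
  -- names no relation.
  arity i := if h : (i : ℕ) < k then ar ⟨i, h⟩ else 0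
  arity_le i := by
    split
    · exact Finset.single_le_sum (f := ar) (fun _ _ => Nat.zero_le _) (Finset.mem_univ _)
    · exact Nat.zero_le _
  update i l :=
    if h : ∃ h : (i : ℕ) < k, l.length = ar ⟨i, h⟩ then
      List.ofFn (upd ⟨i, h.1⟩ fun j => l.get (j.cast h.2.symm)) else l
  length_update i l hl := by
    split at hl
    next h => rw [dif_pos ⟨h, hl⟩, List.length_ofFn, dif_pos h]
    next h => rw [dif_neg fun h' => h h'.1, hl, dif_neg h]
  meet := meet
  top := top
  code i l :=
    if h : ∃ h : (i : ℕ) < k, l.length = ar ⟨i, h⟩ then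
      e ⟨⟨i, h.1⟩, fun j => l.get (j.cast h.2.symm)⟩ else 0

section

variable {upd : ∀ i, (Fin (ar i) → Q) → Fin (ar i) → Q} {meet : Q → Q → Q} {top : Q} {k' : ℕ}
  {e : (Σ i, Fin (ar i) → Q) ≃ Fin k'}

theorem refineRule_arity (i : Fin k) : (refineRule ar upd meet top e).arity i.castSucc = ar i :=
  dif_pos i.2

theorem refineRule_update (i : Fin k) (t : Fin (ar i) → Q) :
    (refineRule ar upd meet top e).update i.castSucc (List.ofFn t) = List.ofFn (upd i t) := by
  refine (dif_pos ⟨i.2, List.length_ofFn⟩).trans ?_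
  congr 2
  funext j
  simp

theorem refineRule_code (i : Fin k) (t : Fin (ar i) → Q) :
    (refineRule ar upd meet top e).code i.castSucc (List.ofFn t) = e ⟨i, t⟩ := by
  refine (dif_pos ⟨i.2, List.length_ofFn⟩).trans ?_
  congr 3
  funext j
  simp

theorem refineRule_code_le (i : Fin (k + 1)) (l : List Q) :
    (refineRule ar upd meet top e).code i l ≤ k' := by
  simp only [refineRule]
  split
  · exact (Fin.is_lt _).le
  · exact Nat.zero_le _

end

/-- The constraints of an instance, with scopes as lists of numbers. -/
def rawConstraint {n : ℕ} (c : Constraint ar n) : Fin (k + 1) × List ℕ :=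
  (c.1.castSucc, List.ofFn fun j => (c.2 j : ℕ))

theorem map_encodeTuple {n m : ℕ} (a : Fin m → Fin n) :
    ((List.ofFn fun j => encodeNat (a j)).flatten.map .inl : List (Bool ⊕ Q)) =
      nums (List.ofFn fun j => (a j : ℕ)) := by
  rw [nums, List.flatMap_def, List.map_flatten, List.map_ofFn, List.map_ofFn]
  rfl

theorem map_encodeInstance (I : Instance ar) :
    ((encodeInstance I).map .inl : List (Bool ⊕ Q)) =
      num I.numVars ++ words (I.constraints.map rawConstraint) := by
  rw [encodeInstance, List.map_append, words, List.flatMap_map, List.flatMap_def,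
    List.map_flatten, List.map_map]
  congr 3
  funext c
  simp only [Function.comp_apply, encodeConstraint, List.map_append, map_encodeTuple]
  rfl

/-- The arity of a renumbered relation equals the old one only propositionally; this moves tuples
across that equality. -/
theorem mem_cast_iff {B : Type*} {D : ∀ x : (Σ i, Fin (ar i) → Q), Set (Fin (ar x.1) → B)}
    {x y : Σ i, Fin (ar i) → Q} (h : y = x) (h' : ar y.1 = ar x.1) (w : Fin (ar x.1) → B) :
    (fun j => w (Fin.cast h' j)) ∈ D y ↔ w ∈ D x := by
  subst h
  rfl

/-- Suppose that the values `s x` of the variables of an instance, when computed by lowering `top`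
along the constraints as long as possible, turn the constraint satisfaction problem over `Δ` into
a problem with constraint relations `D`. If the latter lies in P, so does the former. -/
theorem inP_hasSolution_of_refine {A B : Type*} [Finite Q] (Δ : Fin k → FinRel A)
    (upd : ∀ i, (Fin (Δ i).1 → Q) → Fin (Δ i).1 → Q) (meet : Q → Q → Q) (top : Q)
    (rank : Q → ℕ) (hrank : ∀ r q, meet r q ≠ q → rank (meet r q) < rank q)
    (hmeet : ∀ r q, meet r q = r ∨ meet r q = q)
    (D : ∀ x : (Σ i, Fin (Δ i).1 → Q), Set (Fin (Δ x.1).1 → B))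
    (hD : ∀ (k' : ℕ) (e : Fin k' → Σ i, Fin (Δ i).1 → Q),
      InP (encodeInstance (ar := fun i => (Δ (e i).1).1))
        (HasSolution (A := B) fun i => ⟨(Δ (e i).1).1, D (e i)⟩))
    (h : ∀ (I : Instance fun i => (Δ i).1) (s : Fin I.numVars → Q),
      (∀ P : Fin I.numVars → Q → Prop, (∀ x, P x top) →
        (∀ c ∈ I.constraints, ∀ s' : Fin I.numVars → Q, (∀ x, P x (s' x)) →
          ∀ j, P (c.2 j) (upd c.1 (fun j => s' (c.2 j)) j)) → ∀ x, P x (s x)) →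
      (∀ c ∈ I.constraints, ∀ j,
        meet (upd c.1 (fun j => s (c.2 j)) j) (s (c.2 j)) = s (c.2 j)) →
      (HasSolution Δ I ↔ ∃ g : Fin I.numVars → B, ∀ c ∈ I.constraints,
        (fun j => g (c.2 j)) ∈ D ⟨c.1, fun j => s (c.2 j)⟩)) :
    InP (encodeInstance (ar := fun i => (Δ i).1)) (HasSolution Δ) := by
  classical
  obtain ⟨k', ⟨e⟩⟩ := Finite.exists_equiv_fin (Σ i, Fin (Δ i).1 → Q)
  set R := refineRule (fun i => (Δ i).1) upd meet top e with hR
  refine inP_of_refine (hD k' e.symm) R refineRule_code_le hrank Instance.numVars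
    (fun I => I.constraints.map rawConstraint) ?_ map_encodeInstance ?_
  · intro I c hc
    obtain ⟨c, -, rfl⟩ := List.mem_map.1 hc
    refine ⟨by simp [rawConstraint, hR, refineRule_arity], fun x hx => ?_⟩
    obtain ⟨j, rfl⟩ := (List.mem_ofFn' _ _).1 hx
    exact (c.2 j).2
  · intro I r s hs hpass
    obtain ⟨-, hfix⟩ := R.pass_eq_of_not_changed hpass
    have hlook : ∀ (s : List Q) (c : Constraint (fun i => (Δ i).1) I.numVars),
        R.look s (rawConstraint c).2 = List.ofFn fun j => s.getD (c.2 j) top := by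
      intro s c
      rw [Rule.look, rawConstraint, List.map_ofFn]
      rfl
    have hupd : ∀ (s : List Q) (c : Constraint (fun i => (Δ i).1) I.numVars),
        (R.update (rawConstraint c).1 (R.look s (rawConstraint c).2)).zip (rawConstraint c).2 =
          List.ofFn fun j => (upd c.1 (fun j => s.getD (c.2 j) top) j, (c.2 j : ℕ)) := by
      intro s c
      rw [hlook]
      refine (congrArg (List.zip · _) (refineRule_update c.1 _)).trans ?_
      apply List.ext_getElem
      · simp [rawConstraint]
      · intro j h1 h2
        simp [rawConstraint]
    have hequiv := h I (fun x => s.getD x top) ?_ ?_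
    · refine ⟨⟨I.numVars, I.constraints.map fun c =>
        ⟨e ⟨c.1, fun j => s.getD (c.2 j) top⟩,
          fun j => c.2 (Fin.cast (by simp only [Equiv.symm_apply_apply]) j)⟩⟩, ?_, hequiv.trans ?_⟩
      · rw [map_encodeInstance]
        congr 1
        rw [words, List.flatMap_map, List.flatMap_map, List.flatMap_map]
        congr 1
        funext c
        rw [word, outWord, hlook]
        congr 1
        · congr 1
          exact (refineRule_code c.1 _).symm
        · congr 1
          exact (List.ofFn_congr (by simp only [Equiv.symm_apply_apply]) _)
      · refine exists_congr fun g => ?_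
        simp only [List.mem_map, forall_exists_index, and_imp, forall_apply_eq_imp_iff₂]
        refine forall₂_congr fun c _ => ?_
        exact (mem_cast_iff (ar := fun i => (Δ i).1) (D := D)
          (x := ⟨c.1, fun j => s.getD (c.2 j) top⟩) (e.symm_apply_apply _) _ (fun j => g (c.2 j))).symm
    · intro P htop hP x
      -- The machine's table is indexed by plain numbers, so the invariant is stated under the
      -- proviso that the number names a variable.
      have := R.iterate_pass_induction hmeet (n := I.numVars)
        (P := fun x q => ∀ hx : x < I.numVars, P ⟨x, hx⟩ q)
        (C := I.constraints.map rawConstraint) ?_ (fun x _ hx => htop _) r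
      · rw [← hs] at this
        exact this.2 x x.2 x.2
      · intro c hc s' _ hs' y hy hx
        obtain ⟨c, hc', rfl⟩ := List.mem_map.1 hc
        rw [hupd] at hy
        obtain ⟨j, rfl⟩ := (List.mem_ofFn' _ _).1 hy
        exact hP c hc' (fun x => s'.getD x top) (fun x => hs' x x.2 x.2) j
    · intro c hc j
      have := hfix _ (List.mem_map_of_mem hc)
      rw [hupd] at this
      exact this _ ((List.mem_ofFn' _ _).2 ⟨j, rfl⟩)

end CSP

/-! ### Algebras in the regularization of an irregular variety -/

namespace UnivAlg

open FirstOrder Language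

variable {L : FirstOrder.Language.{u, v}}

theorem mem_varFinset_subst {t : L.Term ℕ} {g : ℕ → L.Term ℕ} {z : ℕ} :
    z ∈ (t.subst g).varFinset ↔ ∃ x ∈ t.varFinset, z ∈ (g x).varFinset := by
  induction t with
  | var => simp [Term.subst]
  | func f ts ih =>
    simp only [Term.subst, Term.varFinset, Finset.mem_biUnion, Finset.mem_univ, true_and, ih]
    exact ⟨fun ⟨i, x, h, h'⟩ => ⟨x, ⟨i, h⟩, h'⟩, fun ⟨x, ⟨i, h⟩, h'⟩ => ⟨i, x, h, h'⟩⟩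

theorem realize_congr {A : Type*} [L.Structure A] {t : L.Term ℕ} {x y : ℕ → A}
    (h : ∀ z ∈ t.varFinset, x z = y z) : t.realize x = t.realize y := by
  induction t with
  | var => exact h _ (by simp)
  | func f ts ih =>
    simp only [Term.realize_func]
    congr 1
    funext i
    exact ih i fun z hz => h z (by simpa using ⟨i, hz⟩)

/-- The term `t(p, q)` for a term `t` in the variables `x₀, x₁`. -/
def star (t p q : L.Term ℕ) : L.Term ℕ :=
  t.subst fun z => if z = 0 then p else q

theorem realize_star {A : Type*} [L.Structure A] (t p q : L.Term ℕ) (x : ℕ → A) :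
    (star t p q).realize x = t.realize fun z => if z = 0 then p.realize x else q.realize x := by
  rw [star, Term.realize_subst]
  congr 1
  funext z
  split <;> rfl

theorem varFinset_star {t : L.Term ℕ} (ht : t.varFinset = {0, 1}) (p q : L.Term ℕ) :
    (star t p q).varFinset = p.varFinset ∪ q.varFinset := by
  ext z
  simp [star, mem_varFinset_subst, ht]

theorem realize_const {V : AlgebraClass L} (hidem : IsIdempotent V) {A : Type u}
    [S : L.Structure A] (hA : V A S) (a : A) (t : L.Term ℕ) : t.realize (fun _ => a) = a := by
  induction t with
  | var => rfl
  | func f ts ih =>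
    simp only [Term.realize_func, ih]
    exact hidem A hA _ f a

/-- A binary term whose value is its first argument: the class is strongly irregular. -/
theorem exists_projection_term (hL : IsPlural L) {V : AlgebraClass L} (hidem : IsIdempotent V)
    {e : Identity L} (he : HoldsIn V e) (hreg : ¬ IsRegular e) :
    ∃ t : L.Term ℕ, t.varFinset = {0, 1} ∧
      ∀ (A : Type u) [S : L.Structure A], V A S → ∀ x : ℕ → A, t.realize x = x 0 := by
  obtain ⟨p, q, z, hp, hq, hpq⟩ : ∃ (p q : L.Term ℕ) (z : ℕ), z ∈ p.varFinset ∧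
      z ∉ q.varFinset ∧ HoldsIn V (p, q) := by
    obtain ⟨p, q⟩ := e
    by_cases h : p.varFinset ⊆ q.varFinset
    · have h' : ¬ q.varFinset ⊆ p.varFinset := fun h' => hreg (Finset.Subset.antisymm h h')
      obtain ⟨z, h1, h2⟩ := Finset.not_subset.1 h'
      exact ⟨q, p, z, h1, h2, fun A _ hA x => (he A hA x).symm⟩
    · obtain ⟨z, h1, h2⟩ := Finset.not_subset.1 h
      exact ⟨p, q, z, h1, h2, he⟩
  obtain ⟨h0, n, hn, ⟨f⟩⟩ := hL
  have hn0 : n ≠ 0 := fun h => h0.elim (h ▸ f)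
  -- Arity `0` is excluded because there are no constants, arity `1` by the choice of `f`.
  obtain ⟨n, rfl⟩ : ∃ r, n = r + 2 := ⟨n - 2, by omega⟩
  set g : L.Term ℕ := .func f fun i => .var (if i = 0 then 0 else 1) with hg
  have hgv : g.varFinset = {0, 1} := by
    ext y
    simp only [hg, Term.varFinset, Finset.mem_biUnion, Finset.mem_univ, true_and,
      Finset.mem_singleton, Finset.mem_insert]
    constructor
    · rintro ⟨i, rfl⟩
      split <;> simp
    · rintro (rfl | rfl)
      · exact ⟨0, rfl⟩
      · exact ⟨1, rfl⟩
  -- Substituting `g`, which contains both variables, for `z` and `x₀` for all others makes both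
  -- variables occur on the side of `p`. The side of `q`, where `z` is missing, becomes a term in
  -- `x₀` alone and collapses to `x₀` by idempotence.
  refine ⟨p.subst fun y => if y = z then g else .var 0, ?_, fun A S hA x => ?_⟩
  · ext y
    rw [mem_varFinset_subst]
    constructor
    · rintro ⟨w, -, hw⟩
      split at hw
      · rwa [hgv] at hw
      · simp only [Term.varFinset, Finset.mem_singleton] at hw
        simp [hw]
    · intro hy
      exact ⟨z, hp, by rwa [if_pos rfl, hgv]⟩
  · rw [Term.realize_subst]
    refine (hpq A hA _).trans ?_
    refine (realize_congr (y := fun _ => x 0) fun y hy => ?_).trans (realize_const hidem hA _ q)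
    rw [if_neg fun h => hq (by rwa [← h])]
    rfl

theorem regularization_le_of_regular {V : AlgebraClass L} (hV : IsVariety V)
    (h : ∀ e, HoldsIn V e → IsRegular e) {A : Type u} [S : L.Structure A]
    (hA : regularization V A S) : V A S := by
  obtain ⟨E, rfl⟩ := hV
  exact ⟨hA.1, fun e he => hA.2 e ⟨h e fun B _ hB => hB.2 e he, fun B _ hB => hB.2 e he⟩⟩

/-- A left normal band operation on an algebra that behaves like the sum operation of a Płonka sum
of algebras from a variety whose identities are `E`. -/
structure SumOperation (E : Set (Identity L)) (A : Type u) [L.Structure A] where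
  mul : A → A → A
  mul_self : ∀ a, mul a a = a
  mul_assoc : ∀ a b c, mul (mul a b) c = mul a (mul b c)
  mul_right_comm : ∀ a b c, mul (mul a b) c = mul (mul a c) b
  map_const : ∀ (n : ℕ) (f : L.Functions n) (a : A), Structure.funMap f (fun _ => a) = a
  map_mul : ∀ (n : ℕ) (f : L.Functions n) (x : Fin n → A) (a : A),
    mul (Structure.funMap f x) a = Structure.funMap f fun i => mul (x i) a
  mul_map : ∀ (n : ℕ) (f : L.Functions n) (x : Fin n → A) (a : A),
    mul a (Structure.funMap f x) = mul a (Structure.funMap f fun i => mul a (x i))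
  mul_comm_of_mem : ∀ e ∈ E, ∀ x : ℕ → A,
    mul (e.1.realize x) (e.2.realize x) = mul (e.2.realize x) (e.1.realize x)
  closed : ∀ (R : CSP.FinRel A), R ∈ Inv L A → ∀ a ∈ R.2, ∀ b ∈ R.2,
    (fun j => mul (a j) (b j)) ∈ R.2

theorem realize_mem_of_inv {A : Type u} [L.Structure A] {R : CSP.FinRel A} (hR : R ∈ Inv L A)
    (t : L.Term ℕ) {x : ℕ → Fin R.1 → A} (hx : ∀ z, x z ∈ R.2) :
    (fun j => t.realize fun z => x z j) ∈ R.2 := by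
  induction t with
  | var => exact hx _
  | func f ts ih => exact hR _ f (fun i j => (ts i).realize fun z => x z j) ih

/-- The laws of the operation are identities with the same variables on both sides. In the original
variety `t` is the first projection, so `mul_self`, the associativity and commutation laws and the
compatibility laws hold there at once, and being regular they pass to `A`. For an identity `p ≈ q`
of `E`, which may be irregular, `t(p, q) ≈ t(q, p)` is still regular and records what survives of
it. -/
theorem exists_sumOperation (hL : IsPlural L) {E : Set (Identity L)}
    (hidem : IsIdempotent (models E)) {t : L.Term ℕ} (ht : t.varFinset = {0, 1})
    (hproj : ∀ (A : Type u) [S : L.Structure A], models E A S → ∀ x : ℕ → A, t.realize x = x 0)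
    {A : Type u} [S : L.Structure A] (hA : regularization (models E) A S) :
    Nonempty (SumOperation E A) := by
  have holds : ∀ p q : L.Term ℕ, p.varFinset = q.varFinset → HoldsIn (models E) (p, q) →
      ∀ x : ℕ → A, p.realize x = q.realize x :=
    fun p q h h' => hA.2 (p, q) ⟨h, h'⟩
  set mul : A → A → A := fun a b => t.realize fun z => if z = 0 then a else b with hmul
  have hstar : ∀ (p q : L.Term ℕ) (x : ℕ → A),
      (star t p q).realize x = mul (p.realize x) (q.realize x) := fun p q x => realize_star t p q x
  have hstar' : ∀ (B : Type u) [T : L.Structure B], models E B T → ∀ (p q : L.Term ℕ) (x : ℕ → B),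
      (star t p q).realize x = p.realize x := by
    intro B T hB p q x
    rw [realize_star, hproj B hB]
    rfl
  have hpos : ∀ (n : ℕ), L.Functions n → 0 < n := by
    intro n f
    rcases Nat.eq_zero_or_pos n with rfl | h
    · exact (hL.1.false f).elim
    · exact h
  refine ⟨⟨mul, fun a => ?_, fun a b c => ?_, fun a b c => ?_, fun n f a => ?_, fun n f x a => ?_,
    fun n f x a => ?_, fun e he x => ?_, fun R hR a ha b hb => ?_⟩⟩
  · have := holds (star t (.var 0) (.var 0)) (.var 0) (by rw [varFinset_star ht]; simp)
      (fun B _ hB x => hstar' B hB _ _ x) fun _ => a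
    rwa [hstar] at this
  · have := holds (star t (star t (.var 0) (.var 1)) (.var 2))
      (star t (.var 0) (star t (.var 1) (.var 2)))
      (by simp only [varFinset_star ht, Finset.union_assoc])
      (fun B _ hB x => by simp only [hstar' B hB])
      fun z => if z = 0 then a else if z = 1 then b else c
    simp only [hstar] at this
    exact this
  · have := holds (star t (star t (.var 0) (.var 1)) (.var 2))
      (star t (star t (.var 0) (.var 2)) (.var 1))
      (by simp only [varFinset_star ht]; rw [Finset.union_right_comm])
      (fun B _ hB x => by simp only [hstar' B hB])
      fun z => if z = 0 then a else if z = 1 then b else c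
    simp only [hstar] at this
    exact this
  · have := holds (.func f fun _ => .var 0) (.var 0)
      (by
        have : Nonempty (Fin n) := ⟨⟨0, hpos n f⟩⟩
        ext z
        simp)
      (fun B _ hB x => hidem B hB n f (x 0)) fun _ => a
    exact this
  · have := holds (star t (.func f fun i => .var (i + 1)) (.var 0))
      (.func f fun i => star t (.var (i + 1)) (.var 0))
      (by
        -- With a nullary `f` the variable `x₀` would be missing on the right and the identity would
        -- not be regular.
        have := hpos n f
        rw [varFinset_star ht]
        ext z
        simp only [Term.varFinset, varFinset_star ht, Finset.mem_union, Finset.mem_biUnion,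
          Finset.mem_univ, true_and, exists_or, exists_const_iff]
        refine or_congr_right ⟨fun h => ⟨⟨⟨0, this⟩⟩, h⟩, fun h => h.2⟩)
      (fun B _ hB x => by
        rw [hstar' B hB]
        simp only [Term.realize_func, hstar' B hB])
      -- The variable `x₀` stands for `a` and `xᵢ₊₁` for the argument `x i`.
      fun z => if h : 0 < z ∧ z - 1 < n then x ⟨z - 1, h.2⟩ else a
    rw [hstar] at this
    simpa [Term.realize_func, hstar] using this
  · have := holds (star t (.var 0) (.func f fun i => .var (i + 1)))
      (star t (.var 0) (.func f fun i => star t (.var 0) (.var (i + 1))))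
      (by
        rw [varFinset_star ht, varFinset_star ht]
        ext z
        simp only [Term.varFinset, varFinset_star ht, Finset.mem_union, Finset.mem_biUnion,
          Finset.mem_univ, true_and, exists_or, exists_const_iff]
        tauto)
      (fun B _ hB x => by simp only [hstar' B hB])
      fun z => if h : 0 < z ∧ z - 1 < n then x ⟨z - 1, h.2⟩ else a
    rw [hstar, hstar] at this
    simpa [Term.realize_func, hstar] using this
  · have := holds (star t e.1 e.2) (star t e.2 e.1)
      (by rw [varFinset_star ht, varFinset_star ht, Finset.union_comm])
      (fun B _ hB x => by simpa only [hstar' B hB] using hB.2 e he x) x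
    simpa only [hstar] using this
  · have := realize_mem_of_inv hR t (x := fun z => if z = 0 then a else b)
      (fun z => by split <;> assumption)
    refine Set.mem_of_eq_of_mem (funext fun j => ?_) this
    refine congrArg t.realize ?_
    funext z
    split <;> rfl

end UnivAlg

/-! ### The Płonka decomposition and the reduction to the product of the summands. -/

namespace UnivAlg

open FirstOrder Language

variable {L : FirstOrder.Language.{u, v}}

namespace SumOperation

variable {E : Set (Identity L)} {A : Type u} [L.Structure A] (o : SumOperation E A)

/-- The quasi-order whose classes are the summands. -/
def le (a b : A) : Prop :=
  o.mul b a = b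

theorem le_refl (a : A) : o.le a a :=
  o.mul_self a

theorem le_trans {a b c : A} (h : o.le a b) (h' : o.le b c) : o.le a c := by
  rw [le] at *
  rw [← h', o.mul_assoc, h]

theorem le_mul_left (a b : A) : o.le a (o.mul a b) := by
  rw [le, o.mul_right_comm, o.mul_self]

theorem le_mul_right (a b : A) : o.le b (o.mul a b) := by
  rw [le, o.mul_assoc, o.mul_self]

theorem mul_le {a b c : A} (h : o.le a c) (h' : o.le b c) : o.le (o.mul a b) c := by
  rw [le] at *
  rw [← o.mul_assoc, h, h']

/-- A product depends on its right factor only through the summand of that factor; this is where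
left normality is needed. -/
theorem mul_congr_right (a : A) {b c : A} (h : o.le b c) (h' : o.le c b) :
    o.mul a b = o.mul a c := by
  rw [le] at *
  rw [← h', ← o.mul_assoc, o.mul_right_comm, o.mul_assoc, h]

/-- The product of two tuples lies above both in every coordinate, so `T` is directed, and a finite
directed set has a greatest member. -/
theorem exists_greatest [Finite A] {ι : Type*} [Finite ι] {T : Set (ι → A)} (hT : T.Nonempty)
    (hmul : ∀ a ∈ T, ∀ b ∈ T, (fun j => o.mul (a j) (b j)) ∈ T) :
    ∃ r ∈ T, ∀ a ∈ T, ∀ j, o.le (a j) (r j) := by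
  have : Nonempty T := hT.to_subtype
  have : IsTrans (ι → A) fun a b => ∀ j, o.le (a j) (b j) :=
    ⟨fun _ _ _ h h' j => o.le_trans (h j) (h' j)⟩
  have hdir : Directed (fun a b : ι → A => ∀ j, o.le (a j) (b j)) fun a : T => (a : ι → A) :=
    fun a b => ⟨⟨_, hmul a a.2 b b.2⟩, fun j => o.le_mul_left _ _, fun j => o.le_mul_right _ _⟩
  obtain ⟨r, hr⟩ := hdir.finite_le id
  exact ⟨r, r.2, fun a ha => hr ⟨a, ha⟩⟩

/-- The summand of `a`. -/
def Fiber (a : A) : Type u :=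
  {b : A // o.le a b ∧ o.le b a}

/-- Summands are subalgebras thanks to idempotence: multiplied into `a`, each argument gives `a`,
and `f(a, …, a) = a`. -/
theorem map_mem_fiber {n : ℕ} (f : L.Functions n) {x : Fin n → A} {a : A}
    (hx : ∀ i, o.le a (x i) ∧ o.le (x i) a) :
    o.le a (Structure.funMap f x) ∧ o.le (Structure.funMap f x) a := by
  constructor
  · rw [le, o.map_mul]
    congr 1
    funext i
    exact (hx i).1
  · have h : (fun i => o.mul a (x i)) = fun _ => a := funext fun i => (hx i).2
    rw [le, o.mul_map, h, o.map_const, o.mul_self]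

/-- The product of all summands. -/
def Product : Type u :=
  ∀ a, o.Fiber a

instance : L.Structure o.Product where
  funMap f x := fun a => ⟨Structure.funMap f fun i => (x i a).1,
    o.map_mem_fiber f fun i => (x i a).2⟩
  RelMap _ _ := False

instance [Finite A] : Finite o.Product := by
  have : ∀ a, Finite (o.Fiber a) := fun a => Subtype.finite
  exact Pi.finite

theorem realize_product (t : L.Term ℕ) (x : ℕ → o.Product) (a : A) :
    (t.realize x a).1 = t.realize fun z => (x z a).1 := by
  induction t with
  | var => rfl
  | func f ts ih =>
    simp only [Term.realize_func, ← ih]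
    rfl

/-- Within one summand `mul` is the first projection, so the law `p * q = q * p` retained for an
identity `p ≈ q` of `E` reads `p = q`. Taking the product of all summands provides a single algebra
of the variety that serves all of them at once. -/
theorem product_mem_models : models E o.Product inferInstance := by
  refine ⟨⟨fun a => ⟨a, o.le_refl a, o.le_refl a⟩⟩, fun e he x => ?_⟩
  funext a
  have hp := (e.1.realize x a).2
  have hq := (e.2.realize x a).2
  refine Subtype.ext ?_
  have h := o.mul_comm_of_mem e he fun z => (x z a).1
  rw [← o.realize_product, ← o.realize_product] at h
  have h1 : o.mul (e.1.realize x a).1 (e.2.realize x a).1 = (e.1.realize x a).1 :=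
    o.le_trans hq.2 hp.1
  have h2 : o.mul (e.2.realize x a).1 (e.1.realize x a).1 = (e.2.realize x a).1 :=
    o.le_trans hp.2 hq.1
  rw [← h1, h, h2]

/-- The number of elements strictly below `a`. -/
noncomputable def rank (a : A) : ℕ :=
  {b | o.le b a ∧ ¬ o.le a b}.ncard

theorem rank_lt_rank [Finite A] {a b : A} (h : o.le a b) (h' : ¬ o.le b a) :
    o.rank a < o.rank b := by
  refine Set.ncard_lt_ncard ⟨fun c hc => ⟨o.le_trans hc.1 h, fun hb => h' ?_⟩, fun hs => ?_⟩
    (Set.toFinite _)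
  · exact o.le_trans hb hc.1
  · exact (hs ⟨h, h'⟩).2 (o.le_refl a)

/-- The relation on the product that `R` induces on the summands of `τ`. -/
def pullback {m : ℕ} (R : Set (Fin m → A)) (τ : Fin m → A) : Set (Fin m → o.Product) :=
  {w | (fun j => (w j (τ j)).1) ∈ R}

theorem pullback_mem_inv {R : CSP.FinRel A} (hR : R ∈ Inv L A) (τ : Fin R.1 → A) :
    (⟨R.1, o.pullback R.2 τ⟩ : CSP.FinRel o.Product) ∈ Inv L o.Product :=
  fun n f a ha => hR n f (fun i j => (a i j (τ j)).1) ha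

open Classical in
/-- The greatest tuple of `R` below `τ`, if there is any. -/
noncomputable def lower [Finite A] {m : ℕ} (R : Set (Fin m → A)) (τ : Fin m → A) : Fin m → A :=
  if h : ∃ r ∈ R, (∀ j, o.le (r j) (τ j)) ∧ ∀ a ∈ R, (∀ j, o.le (a j) (τ j)) →
    ∀ j, o.le (a j) (r j) then h.choose else τ

/-- The tuples of `R` below `τ` are closed under `mul`, so the existence of one such tuple gives a
greatest. The default value `τ` of `lower` is thereby ruled out. -/
theorem lower_spec [Finite A] {R : CSP.FinRel A} (hR : R ∈ Inv L A) {τ a : Fin R.1 → A}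
    (ha : a ∈ R.2) (haτ : ∀ j, o.le (a j) (τ j)) :
    o.lower R.2 τ ∈ R.2 ∧ (∀ j, o.le (o.lower R.2 τ j) (τ j)) ∧
      ∀ j, o.le (a j) (o.lower R.2 τ j) := by
  have h : ∃ r ∈ R.2, (∀ j, o.le (r j) (τ j)) ∧ ∀ a ∈ R.2, (∀ j, o.le (a j) (τ j)) →
      ∀ j, o.le (a j) (r j) := by
    obtain ⟨r, hr, hr'⟩ := o.exists_greatest (T := {a ∈ R.2 | ∀ j, o.le (a j) (τ j)})
      ⟨a, ha, haτ⟩ fun b hb c hc =>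
        ⟨o.closed R hR b hb.1 c hc.1, fun j => o.mul_le (hb.2 j) (hc.2 j)⟩
    exact ⟨r, hr.1, hr.2, fun b hb hb' => hr' b ⟨hb, hb'⟩⟩
  rw [lower, dif_pos h]
  exact ⟨h.choose_spec.1, h.choose_spec.2.1, h.choose_spec.2.2 a ha haτ⟩

/-- The refinement computes for each variable the highest summand still possible; the target problem
asks for a solution with each variable in its summand. One direction multiplies a solution into
these summands, the other reads off a component of the product. -/
theorem isTractable_inv [Finite A] [Nonempty A] (h : CSP.IsTractable (Inv L o.Product)) :
    CSP.IsTractable (Inv L A) := by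
  classical
  intro k Δ hΔ
  -- Stack alphabets live in `Type`, whereas `A` lies in an arbitrary universe.
  obtain ⟨N, ⟨e⟩⟩ := Finite.exists_equiv_fin A
  obtain ⟨top, -, htop⟩ := o.exists_greatest (ι := Unit) (T := Set.univ) Set.univ_nonempty
    fun _ _ _ _ => Set.mem_univ _
  have htop : ∀ a, o.le a (top ()) := fun a => htop (fun _ => a) (Set.mem_univ _) ()
  refine CSP.inP_hasSolution_of_refine (Q := Fin N) (B := o.Product) Δ
    (fun i t j => e (o.lower (Δ i).2 (fun j => e.symm (t j)) j))
    -- A value is replaced only by a strictly lower one. Exchanging equivalent elements would not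
    -- lower the rank, and the refinement might never stop.
    (fun r q => if o.le (e.symm r) (e.symm q) ∧ ¬ o.le (e.symm q) (e.symm r) then r else q)
    (e (top ())) (fun q => o.rank (e.symm q)) (fun r q hrq => ?_) (fun r q => ?_)
    (fun x => o.pullback (Δ x.1).2 fun j => e.symm (x.2 j)) (fun k' f => ?_)
    (fun I s hind hfix => ?_)
  · split at hrq
    next hlt => rw [if_pos hlt]; exact o.rank_lt_rank hlt.1 hlt.2
    next => exact (hrq rfl).elim
  · split <;> simp
  · exact h k' (fun i => ⟨(Δ (f i).1).1, o.pullback (Δ (f i).1).2 fun j => e.symm ((f i).2 j)⟩)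
      fun i => o.pullback_mem_inv (hΔ _) _
  · constructor
    · rintro ⟨g, hg⟩
      -- The tuple of `g` is a tuple of the relation below the current values, so the greatest such
      -- tuple still lies above it.
      have hle : ∀ x, o.le (g x) (e.symm (s x)) := by
        refine hind (fun x q => o.le (g x) (e.symm q)) (fun x => ?_) fun c hc s' hs' j => ?_
        · rw [Equiv.symm_apply_apply]
          exact htop _
        · rw [Equiv.symm_apply_apply]
          exact (o.lower_spec (hΔ c.1) (hg c hc) fun j => hs' (c.2 j)).2.2 j
      -- Only the component at `s x` matters, and there `g x` is multiplied into the summand of `s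
      -- x`; the other components are arbitrary.
      refine ⟨fun x a => ⟨if a = e.symm (s x) then o.mul (g x) a else a, ?_⟩, fun c hc => ?_⟩
      · split
        next ha =>
          subst ha
          exact ⟨o.le_mul_right _ _, o.mul_le (hle x) (o.le_refl _)⟩
        next => exact ⟨o.le_refl a, o.le_refl a⟩
      · obtain ⟨hr, hr', -⟩ := o.lower_spec (hΔ c.1) (τ := fun j => e.symm (s (c.2 j))) (hg c hc)
          fun j => hle (c.2 j)
        -- Otherwise the greatest tuple would be strictly lower at `j` and would have changed the
        -- table.
        have hr'' : ∀ j, o.le (e.symm (s (c.2 j)))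
            (o.lower (Δ c.1).2 (fun j => e.symm (s (c.2 j))) j) := by
          intro j
          by_contra hn
          have := hfix c hc j
          rw [if_pos (by rw [Equiv.symm_apply_apply]; exact ⟨hr' j, hn⟩)] at this
          rw [← this, Equiv.symm_apply_apply] at hn
          exact hn (o.le_refl _)
        -- The solution times the greatest tuple is in the relation, and the greatest tuple may be
        -- exchanged for `s` because both lie in the same summands.
        have := o.closed _ (hΔ c.1) _ (hg c hc) _ hr
        refine Set.mem_of_eq_of_mem (s := (Δ c.1).2) (funext fun j => ?_) this
        refine (if_pos rfl).trans ?_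
        exact o.mul_congr_right _ (hr'' j) (hr' j)
    · rintro ⟨g, hg⟩
      exact ⟨fun x => (g x (e.symm (s x))).1, hg⟩

end SumOperation

end UnivAlg

theorem corollary7p3 (L : FirstOrder.Language.{u, v}) [L.IsAlgebraic] (hL : UnivAlg.IsPlural L)
    (V : UnivAlg.AlgebraClass L) (hV : UnivAlg.IsVariety V)
    (hidem : UnivAlg.IsIdempotent V) (htract : UnivAlg.IsTractable V) :
    UnivAlg.IsVariety (UnivAlg.regularization V) ∧
      UnivAlg.IsTractable (UnivAlg.regularization V) := by
  refine ⟨⟨_, rfl⟩, fun A S _ hA => ?_⟩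
  by_cases hreg : ∀ e, UnivAlg.HoldsIn V e → UnivAlg.IsRegular e
  · exact htract A (UnivAlg.regularization_le_of_regular hV hreg hA)
  · push Not at hreg
    obtain ⟨e, he, he'⟩ := hreg
    obtain ⟨t, ht, hproj⟩ := UnivAlg.exists_projection_term hL hidem he he'
    obtain ⟨E, rfl⟩ := hV
    obtain ⟨o⟩ := UnivAlg.exists_sumOperation hL hidem ht hproj hA
    have := hA.1
    exact o.isTractable_inv (htract o.Product o.product_mem_models)
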